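/- **Notation.** For $s\ge 1$ let $e_s^{x}=[1+(1-s)x]_+^{1/(1-s)}$ ($e_1^x=e^x$), and extend $e_s$ to the imaginary axis by the principal power. Put $\cos_s y=\mathrm{Re}\,e_s^{iy}$ and $\Psi_s(y)=\cos_s(2y)-1$. The $s$-Fourier transform of a probability density $f$ on $\mathbb R$ is $F_s[f](\xi)=\int_{\mathbb R} f(x)\,e_s^{\,ix\xi f(x)^{s-1}}\,dx$; for a random variable with a density, $F_s[X]$ is the transform of its density. The $s$-product is $z\otimes_s w=(z^{1-s}+w^{1-s}-1)^{1/(1-s)}$ ($z\otimes_1 w=zw$). Random variables $X_1,X_2,\dots$ are called $s$-independent if every sum $X_1+\dots+X_N$, $N\ge 2$, has a density and $F_s[X_1+\dots+X_N](\xi)=F_s[X_1](\xi)\otimes_s\cdots\otimes_s F_s[X_N](\xi)$ for all $\xi$ (when $s\neq 1$: for all $\xi$ at which no factor lies on $(-\infty,0]$). Let $\mathcal G_s[\alpha]=\{b\,e_s^{-\beta|x|^\alpha}: b,\beta>0\}$. For $0<\alpha\le 2$ and $q\in[1,\min\{2,1+\alpha\})$ let $$q_{\alpha,n}=1+\frac{\alpha(q-1)}{\alpha-n(q-1)},\qquad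 q^*_{\alpha,n}=1+\frac{2(q_{\alpha,n}-1)}{\alpha}\qquad(n\in\mathbb Z,\ n(q-1)<\alpha).$$ **Theorem.** Let $k\in\mathbb Z$ satisfy $k(q-1)<\alpha$ and $q_{\alpha,k}<2$, and write $Q=q_{\alpha,k}$. Let $X_1,X_2,\dots$ be $Q$-independent random variables with the same symmetric probability density $f$. Assume that $\nu=\int f^{2Q-1}\,dx<\infty$ and that either (i) $\alpha=2$ and $\sigma^2=\nu^{-1}\int x^2f(x)^{2Q-1}\,dx<\infty$; or (ii) $0<\alpha<2$ and $f(x)\sim C|x|^{-(\alpha+1)/(1+\alpha(Q-1))}$ as $|x|\to\infty$ for some constant $C>0$. Put $\mu=\frac{Q}{2}\sigma^2\nu$ in case (i), and in case (ii) $$\mu=\frac{2^{1-\alpha}(1+\alpha(Q-1))}{2-Q}\,C^{\,1+\alpha(Q-1)}\int_0^\infty\frac{-\Psi_{Q}(y)}{y^{\alpha+1}}\,dy .$$ Then $\mu>0$, each $Z_N=(X_1+\dots+X_N)/(\mu N)^{1/(\alpha(2-Q))}$, $N\ge1$, has a density, and $$F_{Q}[Z_N](\xi)\longrightarrow e_{Q}^{-|\xi|^\alpha}\qquad\text{locally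 uniformly in }\xi\in\mathbb R\text{ as }N\to\infty .$$ Moreover, the limit is the $F_{q^*_{\alpha,k-1}}$-image of a $(q_{\alpha,k-1},\alpha)$-stable distribution, in the following sense. (a) If $\alpha=2$, there is a probability density $g\in\mathcal G_{q_{\alpha,k-1}}[\alpha]$ with $F_{q^*_{\alpha,k-1}}[g](\xi)=e_{Q}^{-|\xi|^\alpha}$ for all $\xi$. (b) If $q>1$, it is the image of a probability density $g\in\mathcal G_{q_{\alpha,k-1}}[\alpha]$ in the asymptotic sense: with $s^*=q^*_{\alpha,k-1}$ and $t=(1+s^*)/(3-s^*)$, there are such a $g$, a probability density $h\in\mathcal G_{s^*}[2]$ with $g(x)\sim h(x)$ as $|x|\to\infty$, and $\beta,c>0$ such that $F_{s^*}[h](\xi)=e_t^{-\beta\xi^2}$ for all $\xi$ and $e_t^{-\beta\xi^2}\sim c\,e_{Q}^{-|\xi|^\alpha}$ as $|\xi|\to\infty$; here $c=1$ if $s^*\ne2$. (c) If $q=1$, there is a probability density $g$ (the classical symmetric $\alpha$-stable one) with $F_1[g](\xi)=e^{-|\xi|^\alpha}$ for all $\xi$. -/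

import Mathlib

open MeasureTheory Filter Topology Asymptotics

noncomputable section

namespace QLimit

/-- The real `q`-exponential `e_q^x = [1 + (1 - q) x]_+ ^ (1 / (1 - q))`, with `e_1 = exp`. -/
def qExp (q x : ℝ) : ℝ :=
  if q = 1 then Real.exp x else (max 0 (1 + (1 - q) * x)) ^ (1 / (1 - q))

/-- The complex `q`-exponential (principal branch), used on the imaginary axis only. -/
def qCExp (q : ℝ) (z : ℂ) : ℂ :=
  if q = 1 then Complex.exp z else (1 + (1 - (q : ℂ)) * z) ^ (1 / (1 - (q : ℂ)))

/-- The `q`-cosine, the real part of `e_q^{ix}`. -/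
def qCos (q x : ℝ) : ℝ := (qCExp q (Complex.I * (x : ℂ))).re

/-- `Ψ_q(y) = cos_q(2y) - 1`. -/
def qPsi (q y : ℝ) : ℝ := qCos q (2 * y) - 1

/-- The `q`-Fourier transform `∫ f ⊗_q e_q^{ixξ} dx`, in which, for `f ≥ 0`, the integrand is
`f(x) e_q^{i x ξ f(x)^{q-1}}` (and `0` where `f` vanishes). -/
def qFourier (q : ℝ) (f : ℝ → ℝ) (ξ : ℝ) : ℂ :=
  ∫ x, (f x : ℂ) * qCExp q (Complex.I * ((x * ξ * f x ^ (q - 1) : ℝ) : ℂ))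

/-- The `q`-product `z ⊗_q w = (z^{1-q} + w^{1-q} - 1)^{1/(1-q)}`, the usual product if `q = 1`. -/
def qProd (q : ℝ) (z w : ℂ) : ℂ :=
  if q = 1 then z * w
  else (z ^ (1 - (q : ℂ)) + w ^ (1 - (q : ℂ)) - 1) ^ (1 / (1 - (q : ℂ)))

/-- The iterated `q`-product: `qProdUpTo q z n = z 0 ⊗_q z 1 ⊗_q ⋯ ⊗_q z n` (`n + 1` factors). -/
def qProdUpTo (q : ℝ) (z : ℕ → ℂ) : ℕ → ℂ
  | 0 => z 0
  | n + 1 => qProd q (qProdUpTo q z n) (z (n + 1))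

/-- The `q`-Fourier transform of a random variable is that of its density. -/
def qFourierRV {Ω : Type*} [MeasurableSpace Ω] (q : ℝ) (P : Measure Ω) (X : Ω → ℝ) (ξ : ℝ) : ℂ :=
  qFourier q (fun x => (pdf X P volume x).toReal) ξ

/-- `q`-independence of a sequence: the partial sums `X_0 + ⋯ + X_n` have densities and
`F_q[X_0 + ⋯ + X_n] = F_q[X_0] ⊗_q ⋯ ⊗_q F_q[X_n]`. For `q ≠ 1` the identity is only demanded at
those `ξ` at which no factor lies on `(-∞, 0]`, where the powers in the `q`-product are singular
(for symmetric variables: at which all the factors are positive reals). -/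
def QIndep {Ω : Type*} [MeasurableSpace Ω] (q : ℝ) (P : Measure Ω) (X : ℕ → Ω → ℝ) : Prop :=
  ∀ n : ℕ, 1 ≤ n →
    HasPDF (fun ω => ∑ i ∈ Finset.range (n + 1), X i ω) P volume ∧
    ∀ ξ : ℝ, (q ≠ 1 → ∀ i ≤ n, qFourierRV q P (X i) ξ ∈ Complex.slitPlane) →
      qFourierRV q P (fun ω => ∑ i ∈ Finset.range (n + 1), X i ω) ξ =
        qProdUpTo q (fun i => qFourierRV q P (X i) ξ) n

/-- Probability density functions on the line. -/
structure IsDensity (f : ℝ → ℝ) : Prop where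
  measurable : Measurable f
  nonneg : ∀ x, 0 ≤ f x
  integrable : Integrable f
  integral_eq_one : ∫ x, f x = 1

/-- `𝒢_q[α]`, the set of the functions `b e_q^{-β|x|^α}` with `b, β > 0`. -/
def G (q α : ℝ) : Set (ℝ → ℝ) :=
  {g | ∃ b β : ℝ, 0 < b ∧ 0 < β ∧ ∀ x, g x = b * qExp q (-(β * |x| ^ α))}

/-- The sequence `q_{α,n}`, for integers `n` with `α - n (q - 1) > 0`. -/
def qSeq (α q : ℝ) (n : ℤ) : ℝ := 1 + α * (q - 1) / (α - n * (q - 1))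

/-- `ζ_α(s) = 1 + 2 (s - 1) / α`. -/
def zeta (α s : ℝ) : ℝ := 1 + 2 * (s - 1) / α

/-- The sequence `q*_{α,n} = ζ_α(q_{α,n})`. -/
def qStar (α q : ℝ) (n : ℤ) : ℝ := zeta α (qSeq α q n)

/-- `ν_Q(f) = ∫ f^Q`. -/
def nu (Q : ℝ) (f : ℝ → ℝ) : ℝ := ∫ x, f x ^ Q

/-- The `Q`-variance of a symmetric density. -/
def qVariance (Q : ℝ) (f : ℝ → ℝ) : ℝ := (∫ x, x ^ 2 * f x ^ Q) / nu Q f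

/-- The tail exponent `(α + 1) / (1 + α (q - 1))`. -/
def tailExponent (q α : ℝ) : ℝ := (α + 1) / (1 + α * (q - 1))

/-- `f(x) ~ C |x|^{-(α+1)/(1+α(q-1))}` as `|x| → ∞`, for some constant `C > 0`. -/
def HasStableTail (q α : ℝ) (f : ℝ → ℝ) : Prop :=
  ∃ C : ℝ, 0 < C ∧ Tendsto (fun x => f x * |x| ^ tailExponent q α) (cocompact ℝ) (𝓝 C)

/-- The tail constant `C` of a function with the above tail. -/
def tailConst (q α : ℝ) (f : ℝ → ℝ) : ℝ :=
  limUnder (cocompact ℝ) (fun x => f x * |x| ^ tailExponent q α)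

/-- The standing conditions on the common density: `ν_{2q-1}(f) < ∞`, and either `α = 2` and the
`(2q-1)`-variance is finite, or `α < 2` and `f` has the tail `C |x|^{-(α+1)/(1+α(q-1))}`. -/
def StableCondition (q α : ℝ) (f : ℝ → ℝ) : Prop :=
  Integrable (fun x => f x ^ (2 * q - 1)) ∧
    ((α = 2 ∧ Integrable (fun x => x ^ 2 * f x ^ (2 * q - 1))) ∨
      (α < 2 ∧ HasStableTail q α f))

/-- The constant `μ_{q,α}` of the density `f`. -/
def mu (q α : ℝ) (f : ℝ → ℝ) : ℝ :=
  if α = 2 then q / 2 * qVariance (2 * q - 1) f * nu (2 * q - 1) f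
  else 2 ^ (1 - α) * (1 + α * (q - 1)) / (2 - q) * tailConst q α f ^ (1 + α * (q - 1)) *
    ∫ y in Set.Ioi (0 : ℝ), -qPsi q y / y ^ (α + 1)

/-- The normalized sums `Z_N = (X_0 + ⋯ + X_{N-1}) / (m N)^{1/(α(2-q))}`. -/
def normSum {Ω : Type*} (q α m : ℝ) (X : ℕ → Ω → ℝ) (N : ℕ) (ω : Ω) : ℝ :=
  (∑ i ∈ Finset.range N, X i ω) / (m * N) ^ (1 / (α * (2 - q)))

/-- The function `φ`, with `φ(0) = 1`, on the Fourier side is the image of the density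
`g ∈ 𝒢_s[α]` under `M⁻¹ ∘ F_{s*} ∘ M`, up to the asymptotic factor `c`. Here `s* = ζ_α(s)`. The
first `M` replaces `g` by the density `h ∈ 𝒢_{s*}[2]` (an `s*`-Gaussian) with `g ~ h` at infinity;
the second one replaces `φ` by the function `e_t^{-β|ξ|^2}`, where `t = (1 + s*) / (3 - s*)`, with
`e_t^{-β|ξ|^2} ~ c φ(ξ)` at infinity. For `c = 1` this is the asymptotic meaning of
`F_{s*}[g] = φ`. -/
def IsAsympImage (s α c : ℝ) (g φ : ℝ → ℝ) : Prop :=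
  g ∈ G s α ∧ IsDensity g ∧
  ∃ h ∈ G (zeta α s) 2, IsDensity h ∧ (g ~[cocompact ℝ] h) ∧
  ∃ β : ℝ, 0 < β ∧
    (∀ ξ : ℝ, qFourier (zeta α s) h ξ =
      (qExp ((1 + zeta α s) / (3 - zeta α s)) (-(β * |ξ| ^ (2 : ℝ))) : ℂ)) ∧
    ((fun ξ : ℝ => qExp ((1 + zeta α s) / (3 - zeta α s)) (-(β * |ξ| ^ (2 : ℝ))))
      ~[cocompact ℝ] fun ξ => c * φ ξ)

end QLimit

end

noncomputable section

namespace QLimit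

/-! Write `Q = q_{α,k}`, `w = 1 - cos_Q`, `D = deficit Q f`. For a symmetric density the transform
is real and equals `1 - D`. Everything about the sums follows from one expansion, `D(η) ~ μ |η|^α`
as `η → 0` (`mu_pos_and_tendsto`). With finite variance it is dominated convergence from `w(y) ~
(Q/2) y²`. With a heavy tail, the substitution `x = r u`, with `r` the power of `|η|` that balances
the argument of `w`, turns the tail part into a fixed integral, while the bounded part is `O(η²) =
o(|η|^α)`.

The `Q`-logarithm turns `Q`-products into sums and has derivative `1` at `1`. Dilating a variable by
`a` multiplies the frequency by `a^(2-Q)`, so the normalization of `Z_N` evaluates each factor at `η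
= ξ (μN)^(-1/α)`. The logarithms then add up to `N · (-μ + o(1)) |η|^α → -|ξ|^α`. As `η → 0`, the
factors are eventually positive, which is where `Q`-independence supplies the product formula
(`tendstoLocallyUniformly_normSum`).

The preimages rest on the exact transform of an `s`-Gaussian, a `t`-Gaussian with `t = (1+s)/(3-s)`,
found by completing the square and shifting the contour (`qFourier_qGaussian`). For `α = 2` the
indices fit exactly; for `q > 1` the power tails on both sides have equal exponents and a dilation
adjusts the constants (`exists_isAsympImage`). For `q = 1` the laws of the `Z_N` themselves have
characteristic functions converging to the integrable function `e^{-|ξ|^α}`, and Fourier inversion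
gives the density (`exists_isDensity_of_tendsto_charFun`). -/

/-! ### The `q`-exponential on the imaginary axis -/

lemma one_sub_mul_I_mul_re (q y : ℝ) : (1 + (1 - (q : ℂ)) * (Complex.I * y)).re = 1 := by
  simp

lemma one_sub_mul_I_mul_mem_slitPlane (q y : ℝ) :
    1 + (1 - (q : ℂ)) * (Complex.I * y) ∈ Complex.slitPlane := by
  left
  rw [one_sub_mul_I_mul_re]
  exact one_pos

lemma qCExp_of_ne {q : ℝ} (hq : q ≠ 1) (z : ℂ) :
    qCExp q z = (1 + (1 - (q : ℂ)) * z) ^ (1 / (1 - (q : ℂ))) := by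
  simp [qCExp, hq]

/-- The base has real part `1`, hence modulus at least `1`, and the exponent `1/(1-q)` is negative.
-/
lemma norm_qCExp_le_one {q : ℝ} (hq : 1 ≤ q) (y : ℝ) : ‖qCExp q (Complex.I * y)‖ ≤ 1 := by
  by_cases h : q = 1
  · subst h
    simp [qCExp, mul_comm Complex.I, Complex.norm_exp_ofReal_mul_I]
  · rw [qCExp_of_ne h]
    have e : (1 / (1 - (q : ℂ))) = ((1 / (1 - q) : ℝ) : ℂ) := by push_cast; rfl
    rw [e, Complex.norm_cpow_real]
    have h1 : 1 < q := lt_of_le_of_ne hq (Ne.symm h)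
    apply Real.rpow_le_one_of_one_le_of_nonpos
    · have := Complex.abs_re_le_norm (1 + (1 - (q : ℂ)) * (Complex.I * y))
      rw [one_sub_mul_I_mul_re] at this
      simpa using this
    · exact (one_div_neg.2 (by linarith)).le

lemma continuous_qCExp (q : ℝ) : Continuous fun y : ℝ => qCExp q (Complex.I * y) := by
  by_cases h : q = 1
  · simp only [qCExp, h, if_true]
    fun_prop
  · simp only [qCExp_of_ne h]
    refine continuous_iff_continuousAt.2 fun y => ?_
    exact ContinuousAt.cpow (by fun_prop) continuousAt_const (one_sub_mul_I_mul_mem_slitPlane q y)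

lemma qCExp_zero (q : ℝ) : qCExp q 0 = 1 := by
  by_cases h : q = 1
  · simp [qCExp, h]
  · simp [qCExp_of_ne h]

lemma qCExp_neg (q y : ℝ) :
    qCExp q (Complex.I * ((-y : ℝ) : ℂ)) = (starRingEnd ℂ) (qCExp q (Complex.I * y)) := by
  by_cases h : q = 1
  · simp [qCExp, h, ← Complex.exp_conj]
  · rw [qCExp_of_ne h, qCExp_of_ne h]
    have e : (1 / (1 - (q : ℂ))) = ((1 / (1 - q) : ℝ) : ℂ) := by push_cast; rfl
    rw [e]
    have := Complex.conj_cpow (1 + (1 - (q : ℂ)) * (Complex.I * y)) ((1 / (1 - q) : ℝ) : ℂ)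
      (Complex.mem_slitPlane_iff_arg.1 (one_sub_mul_I_mul_mem_slitPlane q y)).1
    rw [Complex.conj_ofReal] at this
    rw [← this]
    simp

/-- `w_q = 1 - cos_q`. -/
def qVers (q y : ℝ) : ℝ := 1 - qCos q y

lemma qVers_zero (q : ℝ) : qVers q 0 = 0 := by simp [qVers, qCos, qCExp_zero]

lemma qVers_neg (q y : ℝ) : qVers q (-y) = qVers q y := by
  simp only [qVers, qCos]
  rw [qCExp_neg, Complex.conj_re]

lemma continuous_qVers (q : ℝ) : Continuous (qVers q) :=
  continuous_const.sub (Complex.continuous_re.comp (continuous_qCExp q))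

lemma qVers_nonneg {q : ℝ} (hq : 1 ≤ q) (y : ℝ) : 0 ≤ qVers q y := by
  have := (Complex.re_le_norm _).trans (norm_qCExp_le_one hq y)
  simp only [qVers, qCos]; linarith

lemma qVers_le_two {q : ℝ} (hq : 1 ≤ q) (y : ℝ) : qVers q y ≤ 2 := by
  have := (abs_le.1 ((Complex.abs_re_le_norm _).trans (norm_qCExp_le_one hq y))).1
  simp only [qVers, qCos]; linarith

lemma hasDerivAt_one_sub_cpow {q : ℝ} (c : ℂ) (y : ℝ) :
    HasDerivAt (fun y : ℝ => (1 + (1 - (q : ℂ)) * (Complex.I * y)) ^ c)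
      (c * (1 + (1 - (q : ℂ)) * (Complex.I * y)) ^ (c - 1) * ((1 - (q : ℂ)) * Complex.I)) y := by
  have h1 : HasDerivAt (fun z : ℂ => 1 + (1 - (q : ℂ)) * (Complex.I * z))
      ((1 - (q : ℂ)) * Complex.I) (y : ℂ) := by
    have := (((hasDerivAt_id (y : ℂ)).const_mul Complex.I).const_mul (1 - (q : ℂ))).const_add 1
    simpa using this
  exact (h1.cpow_const (one_sub_mul_I_mul_mem_slitPlane q y)).comp_ofReal

/-- Second-order information at the origin, uniform in `q = 1` and `q ≠ 1`: `E` is the derivative up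
to the factor `i`, and only its own derivative at `0` is needed. -/
lemma exists_hasDerivAt_qCExp (q : ℝ) : ∃ E : ℝ → ℂ, E 0 = 1 ∧
    (∀ y : ℝ, HasDerivAt (fun y : ℝ => qCExp q (Complex.I * y)) (Complex.I * E y) y) ∧
    HasDerivAt E (Complex.I * q) 0 := by
  by_cases h : q = 1
  · subst h
    have key : ∀ y : ℝ, HasDerivAt (fun y : ℝ => Complex.exp (Complex.I * y))
        (Complex.I * Complex.exp (Complex.I * y)) y := by
      intro y
      have h1 : HasDerivAt (fun z : ℂ => Complex.I * z) Complex.I (y : ℂ) := by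
        simpa using (hasDerivAt_id (y : ℂ)).const_mul Complex.I
      have := h1.cexp.comp_ofReal
      rwa [mul_comm] at this
    refine ⟨fun y => Complex.exp (Complex.I * y), by simp, ?_, ?_⟩
    · intro y
      simpa [qCExp] using key y
    · simpa using key 0
  · have hne : (1 - (q : ℂ)) ≠ 0 := by
      rw [sub_ne_zero]; exact_mod_cast Ne.symm h
    refine ⟨fun y => (1 + (1 - (q : ℂ)) * (Complex.I * y)) ^ (1 / (1 - (q : ℂ)) - 1), by simp, ?_, ?_⟩
    · intro y
      simp only [qCExp_of_ne h]
      convert hasDerivAt_one_sub_cpow (q := q) (1 / (1 - (q : ℂ))) y using 1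
      field_simp
    · convert hasDerivAt_one_sub_cpow (q := q) (1 / (1 - (q : ℂ)) - 1) 0 using 1
      simp
      field_simp
      ring

/-- One application of L'Hôpital: the derivative of `w_q` is `Im E`, which vanishes at `0` with
slope `q`. -/
lemma tendsto_qVers_div_sq (q : ℝ) :
    Tendsto (fun y => qVers q y / y ^ 2) (𝓝[≠] 0) (𝓝 (q / 2)) := by
  obtain ⟨E, E0, hE, hE0⟩ := exists_hasDerivAt_qCExp q
  have hd : ∀ y, HasDerivAt (qVers q) (E y).im y := by
    intro y
    have := (Complex.reCLM.hasFDerivAt.comp_hasDerivAt y (hE y)).const_sub 1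
    have e : qVers q = fun y : ℝ => 1 - (qCExp q (Complex.I * y)).re := rfl
    rw [e]
    simpa [Function.comp_def] using this
  have him : HasDerivAt (fun y => (E y).im) q 0 := by
    have := Complex.imCLM.hasFDerivAt.comp_hasDerivAt 0 hE0
    simpa [Function.comp_def] using this
  refine HasDerivAt.lhopital_zero_nhdsNE (f' := fun y => (E y).im) (g' := fun y => 2 * y)
    (Eventually.of_forall hd) (Eventually.of_forall fun y => by simpa using hasDerivAt_pow 2 y)
    ?_ ?_ ?_ ?_
  · filter_upwards [self_mem_nhdsWithin] with y hy
    simpa using hy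
  · have := (continuous_qVers q).tendsto 0
    rw [qVers_zero] at this
    exact this.mono_left nhdsWithin_le_nhds
  · have : Tendsto (fun y : ℝ => y ^ 2) (𝓝 0) (𝓝 0) := by
      simpa using (continuous_pow 2).tendsto (0 : ℝ)
    exact this.mono_left nhdsWithin_le_nhds
  · have := (hasDerivAt_iff_tendsto_slope.1 him).div_const 2
    refine this.congr' ?_
    filter_upwards [self_mem_nhdsWithin] with y hy
    simp [slope_def_field, E0]
    field_simp

/-- The quadratic limit near `0` and the bound `w_q ≤ 2` elsewhere. This is the domination behind
all the limits below. -/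
lemma exists_qVers_le {q : ℝ} (hq : 1 ≤ q) : ∃ K : ℝ, 0 < K ∧ ∀ y, qVers q y ≤ K * y ^ 2 := by
  have h := (tendsto_qVers_div_sq q).eventually (gt_mem_nhds (show q / 2 < q / 2 + 1 by linarith))
  rw [eventually_nhdsWithin_iff, Metric.eventually_nhds_iff] at h
  obtain ⟨δ, hδ, h⟩ := h
  refine ⟨max (q / 2 + 1) (2 / δ ^ 2), lt_max_of_lt_left (by linarith), fun y => ?_⟩
  by_cases hy0 : y = 0
  · simp [hy0, qVers_zero]
  have hy2 : 0 < y ^ 2 := by positivity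
  by_cases hy : |y| < δ
  · have := h (by simpa using hy) hy0
    rw [div_lt_iff₀ hy2] at this
    exact this.le.trans (by gcongr; exact le_max_left _ _)
  · have h1 : δ ^ 2 ≤ y ^ 2 := by
      rw [← sq_abs y]; gcongr; exact not_lt.1 hy
    calc qVers q y ≤ 2 := qVers_le_two hq y
      _ = 2 / δ ^ 2 * δ ^ 2 := by field_simp
      _ ≤ 2 / δ ^ 2 * y ^ 2 := by gcongr
      _ ≤ _ := by gcongr; exact le_max_right _ _

lemma exists_qVers_pos {q : ℝ} (hq : 1 ≤ q) : ∃ δ : ℝ, 0 < δ ∧ ∀ y, 0 < y → y < δ → 0 < qVers q y := by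
  have h := (tendsto_qVers_div_sq q).eventually (lt_mem_nhds (show (0:ℝ) < q / 2 by linarith))
  rw [eventually_nhdsWithin_iff, Metric.eventually_nhds_iff] at h
  obtain ⟨δ, hδ, h⟩ := h
  refine ⟨δ, hδ, fun y hy hyδ => ?_⟩
  have := h (by simpa [abs_of_pos hy] using hyδ) hy.ne'
  exact (div_pos_iff_of_pos_right (by positivity)).1 this

/-! ### The transform of a symmetric density near the origin: finite variance -/

/-- `∫ f(x) w_q(x ξ f(x)^{q-1}) dx`, which is `1 - F_q[f](ξ)` for a symmetric density. -/
def deficit (q : ℝ) (f : ℝ → ℝ) (ξ : ℝ) : ℝ := ∫ x, f x * qVers q (x * ξ * f x ^ (q - 1))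

lemma integrable_qFourier {q : ℝ} (hq : 1 ≤ q) {f : ℝ → ℝ} (hf : IsDensity f) (ξ : ℝ) :
    Integrable fun x => (f x : ℂ) * qCExp q (Complex.I * ((x * ξ * f x ^ (q - 1) : ℝ) : ℂ)) := by
  refine (hf.integrable.ofReal (𝕜 := ℂ)).mul_bdd (c := 1) ?_
    (Eventually.of_forall fun x => norm_qCExp_le_one hq _)
  exact ((continuous_qCExp q).measurable.comp
    ((measurable_id.mul_const ξ).mul (hf.measurable.pow_const _))).aestronglyMeasurable

lemma qFourier_eq_one_sub_deficit {q : ℝ} (hq : 1 ≤ q) {f : ℝ → ℝ} (hf : IsDensity f)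
    (hsymm : ∀ x, f (-x) = f x) (ξ : ℝ) : qFourier q f ξ = ((1 - deficit q f ξ : ℝ) : ℂ) := by
  have hint := integrable_qFourier hq hf ξ
  have hre : (qFourier q f ξ).re = 1 - deficit q f ξ := by
    have h1 : (qFourier q f ξ).re = ∫ x, f x - f x * qVers q (x * ξ * f x ^ (q - 1)) := by
      rw [qFourier]
      have := integral_re hint
      simp only [RCLike.re_to_complex] at this
      rw [← this]
      congr 1
      ext x
      rw [Complex.re_ofReal_mul, qVers, qCos]
      ring
    rw [h1, integral_sub hf.integrable, hf.integral_eq_one, deficit]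
    refine hf.integrable.mul_bdd (c := 2) ?_ (Eventually.of_forall fun x => ?_)
    · exact ((continuous_qVers q).measurable.comp
        ((measurable_id.mul_const ξ).mul (hf.measurable.pow_const _))).aestronglyMeasurable
    · rw [Real.norm_of_nonneg (qVers_nonneg hq _)]
      exact qVers_le_two hq _
  -- The transform is real: `x ↦ -x` fixes `f` and conjugates the integrand.
  have hconj : (starRingEnd ℂ) (qFourier q f ξ) = qFourier q f ξ := by
    rw [qFourier, ← integral_conj]
    rw [← integral_neg_eq_self]
    congr 1
    ext x
    rw [hsymm, map_mul, Complex.conj_ofReal, ← qCExp_neg]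
    congr 4
    ring_nf
  rw [← hre, Complex.conj_eq_iff_re.1 hconj]

lemma deficit_nonneg {q : ℝ} (hq : 1 ≤ q) {f : ℝ → ℝ} (hf : IsDensity f) (ξ : ℝ) :
    0 ≤ deficit q f ξ :=
  integral_nonneg fun x => mul_nonneg (hf.nonneg x) (qVers_nonneg hq _)

lemma deficit_abs (q : ℝ) (f : ℝ → ℝ) (ξ : ℝ) : deficit q f |ξ| = deficit q f ξ := by
  unfold deficit
  congr 1
  ext x
  rcases abs_choice ξ with h | h <;> rw [h]
  rw [← qVers_neg]
  congr 2
  ring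

/-- The source of the exponent `2q - 1`: a quadratic bound on `w_q` leaves `f · (f^{q-1})²`. -/
lemma mul_rpow_sq {q y : ℝ} (hq : 1 ≤ q) (hy : 0 ≤ y) :
    y * (y ^ (q - 1)) ^ 2 = y ^ (2 * q - 1) := by
  rcases hy.eq_or_lt with rfl | hy
  · rw [zero_mul, Real.zero_rpow (by linarith)]
  · rw [← Real.rpow_natCast, ← Real.rpow_mul hy.le]
    nth_rewrite 1 [← Real.rpow_one y]
    rw [← Real.rpow_add hy]
    congr 1
    push_cast
    ring

lemma aestronglyMeasurable_deficit {q : ℝ} {f : ℝ → ℝ} (hf : IsDensity f) (ξ : ℝ)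
    (μ : Measure ℝ) :
    AEStronglyMeasurable (fun x => f x * qVers q (x * ξ * f x ^ (q - 1))) μ :=
  (hf.measurable.mul ((continuous_qVers q).measurable.comp
        ((measurable_id.mul_const ξ).mul (hf.measurable.pow_const _)))).aestronglyMeasurable

lemma integrable_deficit {q : ℝ} (hq : 1 ≤ q) {f : ℝ → ℝ} (hf : IsDensity f) (ξ : ℝ) :
    Integrable (fun x => f x * qVers q (x * ξ * f x ^ (q - 1))) := by
  refine (hf.integrable.mul_const 2).mono' (aestronglyMeasurable_deficit hf ξ _)
    (Eventually.of_forall fun x => ?_)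
  rw [Real.norm_of_nonneg (mul_nonneg (hf.nonneg x) (qVers_nonneg hq _))]
  exact mul_le_mul_of_nonneg_left (qVers_le_two hq _) (hf.nonneg x)

lemma tendsto_deficit_div_sq {q : ℝ} (hq : 1 ≤ q) {f : ℝ → ℝ} (hf : IsDensity f)
    (h2 : Integrable fun x => x ^ 2 * f x ^ (2 * q - 1)) :
    Tendsto (fun η => deficit q f η / η ^ 2) (𝓝[≠] 0)
      (𝓝 (q / 2 * ∫ x, x ^ 2 * f x ^ (2 * q - 1))) := by
  obtain ⟨K, hK, hKw⟩ := exists_qVers_le hq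
  rw [← integral_const_mul]
  simp only [deficit, ← integral_div]
  refine tendsto_integral_filter_of_dominated_convergence
    (fun x => K * (x ^ 2 * f x ^ (2 * q - 1))) ?_ ?_ (h2.const_mul K) ?_
  · refine Eventually.of_forall fun η => ?_
    simpa [div_eq_mul_inv] using (aestronglyMeasurable_deficit hf η volume).mul_const ((η ^ 2)⁻¹)
  · filter_upwards [self_mem_nhdsWithin] with η hη
    refine Eventually.of_forall fun x => ?_
    have hη2 : 0 < η ^ 2 := by have : η ≠ 0 := hη; positivity
    rw [Real.norm_of_nonneg (div_nonneg (mul_nonneg (hf.nonneg x) (qVers_nonneg hq _)) hη2.le),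
      div_le_iff₀ hη2]
    refine (mul_le_mul_of_nonneg_left (hKw _) (hf.nonneg x)).trans_eq ?_
    rw [← mul_rpow_sq hq (hf.nonneg x)]
    ring
  · refine Eventually.of_forall fun x => ?_
    rw [← mul_rpow_sq hq (hf.nonneg x)]
    set p := f x ^ (q - 1)
    -- If `x p = 0` the argument of `w_q` is constantly `0`; otherwise `η ↦ x p η` preserves
    -- punctured neighbourhoods of `0`.
    by_cases hz : x * p = 0
    · have e : ∀ η, f x * qVers q (x * η * p) / η ^ 2 = 0 := by
        intro η
        rw [show x * η * p = (x * p) * η by ring, hz, zero_mul, qVers_zero]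
        simp
      simp only [e]
      rw [show q / 2 * (x ^ 2 * (f x * p ^ 2)) = q / 2 * f x * (x * p) ^ 2 by ring, hz]
      simp
    · have ht : Tendsto (fun η => (x * p) * η) (𝓝[≠] 0) (𝓝[≠] 0) := by
        refine tendsto_nhdsWithin_iff.2 ⟨?_, ?_⟩
        · have : Tendsto (fun η => (x * p) * η) (𝓝 0) (𝓝 ((x * p) * 0)) :=
            (continuous_const.mul continuous_id).tendsto 0
          rw [mul_zero] at this
          exact this.mono_left nhdsWithin_le_nhds
        · filter_upwards [self_mem_nhdsWithin] with η hη
          exact mul_ne_zero hz hη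
      have := ((tendsto_qVers_div_sq q).comp ht).mul_const (f x * (x * p) ^ 2)
      convert this using 1
      · ext η
        simp only [Function.comp]
        rw [show x * η * p = (x * p) * η by ring, mul_pow]
        by_cases hη : η = 0
        · simp [hη]
        · obtain ⟨hx, hp⟩ := mul_ne_zero_iff.1 hz
          generalize qVers q (x * p * η) = W
          field_simp
      · congr 1
        ring

/-! ### The transform of a symmetric density near the origin: heavy tails -/

lemma integrableOn_ite_rpow {a b : ℝ} (ha : -1 < a) (hb : b < -1) :
    IntegrableOn (fun u : ℝ => if u ≤ 1 then u ^ a else u ^ b) (Set.Ioi 0) := by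
  rw [← Set.Ioc_union_Ioi_eq_Ioi zero_le_one]
  refine IntegrableOn.union ?_ ?_
  · refine IntegrableOn.congr_fun (f := fun u : ℝ => u ^ a) ?_ ?_ measurableSet_Ioc
    · exact (intervalIntegrable_iff_integrableOn_Ioc_of_le zero_le_one).1
        (intervalIntegral.intervalIntegrable_rpow' ha)
    · intro u hu
      simp [hu.2]
  · refine IntegrableOn.congr_fun (f := fun u : ℝ => u ^ b) ?_ ?_ measurableSet_Ioi
    · exact integrableOn_Ioi_rpow_of_lt hb zero_lt_one
    · intro u hu
      simp [not_le.2 (Set.mem_Ioi.1 hu)]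

lemma qPsi_eq (q y : ℝ) : -qPsi q y = qVers q (2 * y) := by
  simp [qPsi, qVers]

lemma integrableOn_qPsi {q α : ℝ} (hq : 1 ≤ q) (h0 : 0 < α) (h2 : α < 2) :
    IntegrableOn (fun y => -qPsi q y / y ^ (α + 1)) (Set.Ioi 0) := by
  obtain ⟨K, hK, hKw⟩ := exists_qVers_le hq
  refine Integrable.mono'
    -- `w_q(2y) ≤ 4K y²` is used for `y ≤ 1` and `w_q ≤ 2` for `y > 1`; `4K + 2` covers both.
    ((integrableOn_ite_rpow (a := 1 - α) (b := -α - 1) (by linarith) (by linarith)).const_mul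
      (4 * K + 2)) ?_ ?_
  · simp only [qPsi_eq]
    exact (((continuous_qVers q).measurable.comp (measurable_const.mul measurable_id)).div
      (measurable_id.pow_const _)).aestronglyMeasurable
  · filter_upwards [ae_restrict_mem measurableSet_Ioi] with y hy
    have hy : 0 < y := hy
    rw [qPsi_eq, Real.norm_of_nonneg (by have := qVers_nonneg hq (2 * y); positivity)]
    split_ifs with h
    · rw [show 1 - α = 2 - (α + 1) by ring, Real.rpow_sub hy, Real.rpow_two, ← mul_div_assoc]
      gcongr
      nlinarith [hKw (2 * y), sq_nonneg y]
    · rw [show -α - 1 = -(α + 1) by ring, Real.rpow_neg hy.le, ← div_eq_mul_inv]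
      gcongr
      linarith [qVers_le_two hq (2 * y)]

lemma integral_qPsi_pos {q α : ℝ} (hq : 1 ≤ q) (h0 : 0 < α) (h2 : α < 2) :
    0 < ∫ y in Set.Ioi (0 : ℝ), -qPsi q y / y ^ (α + 1) := by
  obtain ⟨δ, hδ, hpos⟩ := exists_qVers_pos hq
  rw [setIntegral_pos_iff_support_of_nonneg_ae _ (integrableOn_qPsi hq h0 h2)]
  · have hsub : Set.Ioo 0 (δ / 2) ⊆
        Function.support (fun y => -qPsi q y / y ^ (α + 1)) ∩ Set.Ioi 0 := by
      intro y hy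
      refine ⟨?_, hy.1⟩
      rw [Function.mem_support, qPsi_eq]
      have := hpos (2 * y) (by linarith [hy.1]) (by linarith [hy.2])
      have := Real.rpow_pos_of_pos hy.1 (α + 1)
      positivity
    refine lt_of_lt_of_le ?_ (measure_mono hsub)
    simp [hδ]
  · filter_upwards [ae_restrict_mem measurableSet_Ioi] with y hy
    have hy : 0 < y := hy
    rw [qPsi_eq]
    have := qVers_nonneg hq (2 * y)
    simp only [Pi.zero_apply]
    positivity

/-- Substitute `y = (c/2) u^κ`; the relation `γ = 1 + κα` makes `u^{-γ} du` a multiple of `y^{-α-1}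
dy`. -/
lemma integral_rpow_mul_qVers_comp {q α κ γ c : ℝ} (hκ : 0 < κ)
    (hγ : γ = 1 + κ * α) (hc : 0 < c) :
    ∫ u in Set.Ioi (0 : ℝ), u ^ (-γ) * qVers q (u ^ κ * c) =
      κ⁻¹ * (c / 2) ^ α * ∫ y in Set.Ioi (0 : ℝ), -qPsi q y / y ^ (α + 1) := by
  have hb : 0 < c / 2 := by positivity
  set h : ℝ → ℝ := fun y => -qPsi q y / y ^ (α + 1) with hh
  have h1 := integral_comp_rpow_Ioi (fun y => h (c / 2 * y)) hκ.ne'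
  rw [integral_comp_mul_left_Ioi h 0 hb, mul_zero] at h1
  simp only [smul_eq_mul] at h1
  have h2 : ∫ u in Set.Ioi (0 : ℝ), |κ| * u ^ (κ - 1) * h (c / 2 * u ^ κ) =
      κ * (c / 2) ^ (-(α + 1)) * ∫ u in Set.Ioi (0 : ℝ), u ^ (-γ) * qVers q (u ^ κ * c) := by
    rw [← integral_const_mul]
    refine setIntegral_congr_fun measurableSet_Ioi fun u hu => ?_
    have hu : 0 < u := hu
    simp only [hh, qPsi_eq, abs_of_pos hκ]
    rw [show 2 * (c / 2 * u ^ κ) = u ^ κ * c by ring,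
      Real.mul_rpow hb.le (Real.rpow_nonneg hu.le _), ← Real.rpow_mul hu.le,
      show -γ = (κ - 1) - κ * (α + 1) by rw [hγ]; ring, Real.rpow_sub hu _ (κ * (α + 1)),
      Real.rpow_neg hb.le]
    field_simp
  rw [h2] at h1
  have h3 : (0 : ℝ) < (c / 2) ^ α := Real.rpow_pos_of_pos hb _
  rw [Real.rpow_neg hb.le, Real.rpow_add_one hb.ne'] at h1
  field_simp at h1 ⊢
  linear_combination h1

/-- With `γ` the tail exponent and `κ = (2-q)/(1+α(q-1))`, a density decaying like `x^{-γ}` has tail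
mass of order `x^{-κα}`. By the next lemma, `x f(x)^{q-1}` then grows like `x^κ`. -/
lemma tailExponent_eq {q α : ℝ} (hq : 1 ≤ q) (h0 : 0 < α) :
    tailExponent q α = 1 + (2 - q) / (1 + α * (q - 1)) * α := by
  have : 0 < 1 + α * (q - 1) := by nlinarith
  unfold tailExponent
  field_simp
  ring

lemma one_sub_tailExponent_mul {q α : ℝ} (hq : 1 ≤ q) (h0 : 0 < α) :
    1 - tailExponent q α * (q - 1) = (2 - q) / (1 + α * (q - 1)) := by
  have : 0 < 1 + α * (q - 1) := by nlinarith
  unfold tailExponent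
  field_simp
  ring

lemma deficit_eq_two_mul (q : ℝ) {f : ℝ → ℝ} (hsymm : ∀ x, f (-x) = f x) (η : ℝ) :
    deficit q f η = 2 * ∫ x in Set.Ioi 0, f x * qVers q (x * η * f x ^ (q - 1)) := by
  rw [deficit, ← integral_comp_abs (f := fun x => f x * qVers q (x * η * f x ^ (q - 1)))]
  congr 1
  ext x
  rcases abs_choice x with h | h <;> rw [h]
  rw [hsymm, ← qVers_neg]
  congr 2
  ring

/-- The part of the deficit coming from `x > R` in the regime of a regular tail. -/
lemma tendsto_deficit_tail {q α : ℝ} (hq : 1 ≤ q) (hq2 : q < 2) (h0 : 0 < α) (h2 : α < 2)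
    {f : ℝ → ℝ} (hf : IsDensity f) {C : ℝ} (hC : 0 < C)
    (htail : Tendsto (fun x => f x * |x| ^ tailExponent q α) atTop (𝓝 C)) {R : ℝ}
    (hbd : ∀ x, R < x → f x * |x| ^ tailExponent q α ≤ 2 * C) :
    Tendsto (fun r : ℝ => r ^ (tailExponent q α - 1) * ∫ x in Set.Ioi 0,
        (Set.Ioi R).indicator (fun x => f x * qVers q
          (x * r ^ (-((2 - q) / (1 + α * (q - 1)))) * f x ^ (q - 1))) x) atTop
      (𝓝 (∫ u in Set.Ioi (0 : ℝ), C * (u ^ (-tailExponent q α) *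
        qVers q (u ^ ((2 - q) / (1 + α * (q - 1))) * C ^ (q - 1))))) := by
  have hd : 0 < 1 + α * (q - 1) := by nlinarith
  set γ := tailExponent q α with hγ
  set κ := (2 - q) / (1 + α * (q - 1)) with hκ
  have hκ0 : 0 < κ := div_pos (by linarith) hd
  have hγκ : γ = 1 + κ * α := tailExponent_eq hq h0
  have hκγ : 1 - γ * (q - 1) = κ := one_sub_tailExponent_mul hq h0
  obtain ⟨K, hK, hKw⟩ := exists_qVers_le hq
  obtain ⟨L, hL⟩ : ∃ L : ℝ → ℝ, ∀ x, L x = f x * |x| ^ γ := ⟨_, fun _ => rfl⟩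
  simp only [← hL] at htail hbd
  have hL0 : ∀ x, 0 ≤ L x := fun x => by
    rw [hL]; exact mul_nonneg (hf.nonneg x) (by positivity)
  -- The integrand after `x = r u`, written through `L(x) = f(x) |x|^γ → C`. All powers of `r`
  -- cancel, because `1 - κ - γ(q-1) = 0`, so `r` survives only inside `L` and the cutoff.
  set G : ℝ → ℝ → ℝ := fun r u => (Set.Ioi R).indicator (fun x => L x) (r * u) *
    (u ^ (-γ) * qVers q (u ^ κ * L (r * u) ^ (q - 1))) with hG
  have hLm : Measurable L := by
    rw [show L = fun x => f x * |x| ^ γ from funext hL]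
    exact hf.measurable.mul (measurable_id.abs.pow_const _)
  have key : ∀ r, 0 < r → r ^ (γ - 1) * ∫ x in Set.Ioi 0,
        (Set.Ioi R).indicator (fun x => f x * qVers q (x * r ^ (-κ) * f x ^ (q - 1))) x =
        ∫ u in Set.Ioi 0, G r u := by
    intro r hr
    have := integral_comp_mul_left_Ioi' (fun x =>
      (Set.Ioi R).indicator (fun x => f x * qVers q (x * r ^ (-κ) * f x ^ (q - 1))) x) 0 hr
    rw [mul_zero] at this
    rw [← this, smul_eq_mul, ← mul_assoc, ← Real.rpow_add_one hr.ne', ← integral_const_mul]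
    refine setIntegral_congr_fun measurableSet_Ioi fun u hu => ?_
    have hu : 0 < u := hu
    have hru : 0 < r * u := mul_pos hr hu
    simp only [hG, Set.indicator]
    split_ifs with h
    · have hfL : f (r * u) = L (r * u) * (r ^ (-γ) * u ^ (-γ)) := by
        rw [hL, abs_of_pos hru]
        rw [← Real.mul_rpow hr.le hu.le, mul_assoc, ← Real.rpow_add hru]
        simp
      have harg : r * u * r ^ (-κ) * f (r * u) ^ (q - 1) = u ^ κ * L (r * u) ^ (q - 1) := by
        rw [hfL, Real.mul_rpow (hL0 _) (by positivity), Real.mul_rpow (by positivity) (by positivity),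
          ← Real.rpow_mul hr.le, ← Real.rpow_mul hu.le]
        have e1 : r * r ^ (-κ) * r ^ (-γ * (q - 1)) = 1 := by
          nth_rewrite 1 [← Real.rpow_one r]
          rw [← Real.rpow_add hr, ← Real.rpow_add hr,
            show 1 + -κ + -γ * (q - 1) = 0 by rw [← hκγ]; ring, Real.rpow_zero]
        have e2 : u * u ^ (-γ * (q - 1)) = u ^ κ := by
          nth_rewrite 1 [← Real.rpow_one u]
          rw [← Real.rpow_add hu, ← hκγ]
          congr 1
          ring
        rw [← e2]
        linear_combination (L (r * u) ^ (q - 1) * u * u ^ (-γ * (q - 1))) * e1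
      rw [harg, hfL, sub_add_cancel]
      have e3 : r ^ γ * r ^ (-γ) = 1 := by rw [← Real.rpow_add hr]; simp
      linear_combination (L (r * u) * u ^ (-γ) * qVers q (u ^ κ * L (r * u) ^ (q - 1))) * e3
    · simp
  refine Tendsto.congr' (f₁ := fun r => ∫ u in Set.Ioi 0, G r u) ?_ ?_
  · filter_upwards [eventually_gt_atTop 0] with r hr
    exact (key r hr).symm
  have hCq : 0 < (2 * C) ^ (q - 1) := Real.rpow_pos_of_pos (by positivity) _
  refine tendsto_integral_filter_of_dominated_convergence
    -- Beyond `R` one has `L ≤ 2C`. The bound `w_q(y) ≤ K y²` serves `u ≤ 1` and `w_q ≤ 2` serves `u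
    -- > 1`; the constant dominates both.
    (fun u => (2 * C) * (2 + K * ((2 * C) ^ (q - 1)) ^ 2) *
      if u ≤ 1 then u ^ (2 * κ - γ) else u ^ (-γ)) ?_ ?_ ?_ ?_
  · refine Eventually.of_forall fun r => ?_
    have hm : Measurable fun u : ℝ => r * u := measurable_const.mul measurable_id
    exact (((hLm.indicator measurableSet_Ioi).comp hm).mul ((measurable_id.pow_const _).mul
      ((continuous_qVers q).measurable.comp ((measurable_id.pow_const _).mul
        ((hLm.comp hm).pow_const _))))).aestronglyMeasurable
  · filter_upwards [eventually_gt_atTop 0] with r hr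
    filter_upwards [ae_restrict_mem measurableSet_Ioi] with u hu
    have hu : 0 < u := hu
    simp only [hG, Set.indicator]
    have hpos : (0:ℝ) ≤ if u ≤ 1 then u ^ (2 * κ - γ) else u ^ (-γ) := by split_ifs <;> positivity
    split_ifs at hpos ⊢ with h h1 h1
    · rw [Real.norm_of_nonneg (mul_nonneg (hL0 _) (mul_nonneg (by positivity) (qVers_nonneg hq _))),
        mul_assoc]
      refine mul_le_mul (hbd _ h) ?_ (mul_nonneg (by positivity) (qVers_nonneg hq _))
        (by positivity)
      have hw : qVers q (u ^ κ * L (r * u) ^ (q - 1)) ≤ K * ((2 * C) ^ (q - 1)) ^ 2 * (u ^ κ) ^ 2 := by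
        refine (hKw _).trans ?_
        rw [mul_pow]
        have : L (r * u) ^ (q - 1) ≤ (2 * C) ^ (q - 1) :=
          Real.rpow_le_rpow (hL0 _) (hbd _ h) (by linarith)
        have h5 : (L (r * u) ^ (q - 1)) ^ 2 ≤ ((2 * C) ^ (q - 1)) ^ 2 :=
          pow_le_pow_left₀ (Real.rpow_nonneg (hL0 _) _) this 2
        calc K * ((u ^ κ) ^ 2 * (L (r * u) ^ (q - 1)) ^ 2)
            ≤ K * ((u ^ κ) ^ 2 * ((2 * C) ^ (q - 1)) ^ 2) := by gcongr
          _ = _ := by ring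
      have e : u ^ (2 * κ - γ) = u ^ (-γ) * (u ^ κ) ^ 2 := by
        rw [← Real.rpow_natCast (u ^ κ), ← Real.rpow_mul hu.le, ← Real.rpow_add hu]
        congr 1
        push_cast
        ring
      rw [e]
      have h6 : (0:ℝ) ≤ u ^ (-γ) := by positivity
      nlinarith [mul_le_mul_of_nonneg_left hw h6, mul_nonneg h6 (sq_nonneg (u ^ κ))]
    · rw [Real.norm_of_nonneg (mul_nonneg (hL0 _) (mul_nonneg (by positivity) (qVers_nonneg hq _))),
        mul_assoc]
      refine mul_le_mul (hbd _ h) ?_ (mul_nonneg (by positivity) (qVers_nonneg hq _))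
        (by positivity)
      rw [mul_comm]
      gcongr
      have := qVers_le_two hq (u ^ κ * L (r * u) ^ (q - 1))
      have : 0 ≤ K * ((2 * C) ^ (q - 1)) ^ 2 := by positivity
      linarith
    · rw [zero_mul, norm_zero]; positivity
    · rw [zero_mul, norm_zero]; positivity
  -- The exponents are `2κ - γ = -1 + κ(2-α) > -1`, by `α < 2`, and `-γ = -1 - κα < -1`.
  · refine (integrableOn_ite_rpow ?_ ?_).const_mul _
    · rw [hγκ]; nlinarith
    · rw [hγκ]; nlinarith
  · filter_upwards [ae_restrict_mem measurableSet_Ioi] with u hu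
    have hu : 0 < u := hu
    have hru : Tendsto (fun r : ℝ => r * u) atTop atTop := tendsto_id.atTop_mul_const hu
    have hLr : Tendsto (fun r => L (r * u)) atTop (𝓝 C) := htail.comp hru
    have hLr' : Tendsto (fun r => (Set.Ioi R).indicator (fun x => L x) (r * u)) atTop (𝓝 C) := by
      refine hLr.congr' ?_
      filter_upwards [hru.eventually_gt_atTop R] with r hr
      rw [Set.indicator_of_mem (Set.mem_Ioi.2 hr)]
    refine hLr'.mul (tendsto_const_nhds.mul ?_)
    refine ((continuous_qVers q).tendsto _).comp (tendsto_const_nhds.mul ?_)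
    exact hLr.rpow_const (Or.inl hC.ne')

/-- Split at a fixed `R`. The part `|x| > R` converges by `tendsto_deficit_tail` with `r =
|η|^{-1/κ}`; the rest is `O(R² η² ∫ f^{2q-1})`, negligible against `|η|^α` because `α < 2`. -/
lemma tendsto_deficit_div_rpow {q α : ℝ} (hq : 1 ≤ q) (hq2 : q < 2) (h0 : 0 < α) (h2 : α < 2)
    {f : ℝ → ℝ} (hf : IsDensity f) (hsymm : ∀ x, f (-x) = f x)
    (hν : Integrable (fun x => f x ^ (2 * q - 1))) {C : ℝ} (hC : 0 < C)
    (htail : Tendsto (fun x => f x * |x| ^ tailExponent q α) (cocompact ℝ) (𝓝 C)) :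
    Tendsto (fun η => deficit q f η / |η| ^ α) (𝓝[≠] 0)
      (𝓝 (2 ^ (1 - α) * (1 + α * (q - 1)) / (2 - q) * C ^ (1 + α * (q - 1)) *
        ∫ y in Set.Ioi (0 : ℝ), -qPsi q y / y ^ (α + 1))) := by
  have hd : 0 < 1 + α * (q - 1) := by nlinarith
  have htop := htail.mono_left atTop_le_cocompact
  set γ := tailExponent q α with hγ
  set κ := (2 - q) / (1 + α * (q - 1)) with hκ
  have hκ0 : 0 < κ := div_pos (by linarith) hd
  have hγκ : γ = 1 + κ * α := tailExponent_eq hq h0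
  obtain ⟨K, hK, hKw⟩ := exists_qVers_le hq
  obtain ⟨R0, hR0⟩ := eventually_atTop.1
    (htop.eventually (ge_mem_nhds (show C < 2 * C by linarith)))
  set R := max R0 1
  have hR : 0 < R := lt_max_of_lt_right one_pos
  have hbd : ∀ x, R < x → f x * |x| ^ γ ≤ 2 * C := fun x hx => hR0 x ((le_max_left _ _).trans hx.le)
  have htl := tendsto_deficit_tail hq hq2 h0 h2 hf hC htop hbd
  simp only [← hγ, ← hκ] at htl
  rw [integral_const_mul,
    integral_rpow_mul_qVers_comp hκ0 hγκ (Real.rpow_pos_of_pos hC _)] at htl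
  -- pass to the variable `η = r ^ (-κ)`
  have hr : Tendsto (fun η : ℝ => |η| ^ (-κ⁻¹)) (𝓝[≠] 0) atTop := by
    have h1 : Tendsto (fun η : ℝ => |η|) (𝓝[≠] 0) (𝓝[>] 0) := by
      refine tendsto_nhdsWithin_iff.2 ⟨?_, ?_⟩
      · have := (continuous_abs (G := ℝ)).tendsto 0
        rw [abs_zero] at this
        exact this.mono_left nhdsWithin_le_nhds
      · filter_upwards [self_mem_nhdsWithin] with η hη
        exact abs_pos.2 hη
    exact (tendsto_rpow_neg_nhdsGT_zero (by simpa using hκ0)).comp h1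
  have hmain := (htl.comp hr).const_mul 2
  -- the central part is negligible
  have hsmall : Tendsto (fun η : ℝ => |η| ^ (2 - α) * (2 * K * R ^ 2 * ∫ x, f x ^ (2 * q - 1)))
      (𝓝[≠] 0) (𝓝 0) := by
    have h1 : Tendsto (fun η : ℝ => |η| ^ (2 - α)) (𝓝 0) (𝓝 0) := by
      have := ((continuous_abs (G := ℝ)).tendsto 0).rpow_const (p := 2 - α) (Or.inr (by linarith))
      rwa [abs_zero, Real.zero_rpow (by linarith)] at this
    simpa using (h1.mono_left nhdsWithin_le_nhds).mul_const _
  obtain ⟨T, hT⟩ : ∃ T : ℝ → ℝ, ∀ η, T η = |η| ^ (-α) * ∫ x in Set.Ioi 0,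
    (Set.Ioi R).indicator (fun x => f x * qVers q (x * |η| * f x ^ (q - 1))) x := ⟨_, fun _ => rfl⟩
  have hT1 : Tendsto (fun η => 2 * T η) (𝓝[≠] 0)
      (𝓝 (2 ^ (1 - α) * (1 + α * (q - 1)) / (2 - q) * C ^ (1 + α * (q - 1)) *
        ∫ y in Set.Ioi (0 : ℝ), -qPsi q y / y ^ (α + 1))) := by
    have e : 2 * (C * (κ⁻¹ * (C ^ (q - 1) / 2) ^ α *
          ∫ y in Set.Ioi (0 : ℝ), -qPsi q y / y ^ (α + 1))) =
        2 ^ (1 - α) * (1 + α * (q - 1)) / (2 - q) * C ^ (1 + α * (q - 1)) *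
        ∫ y in Set.Ioi (0 : ℝ), -qPsi q y / y ^ (α + 1) := by
      rw [Real.div_rpow (by positivity) zero_le_two, ← Real.rpow_mul hC.le,
        Real.rpow_add hC, Real.rpow_one, Real.rpow_sub two_pos, Real.rpow_one, hκ, inv_div,
        mul_comm α (q - 1)]
      ring
    rw [← e]
    refine hmain.congr' ?_
    filter_upwards [self_mem_nhdsWithin] with η hη
    have hη : 0 < |η| := abs_pos.2 hη
    simp only [Function.comp]
    rw [hT, ← Real.rpow_mul hη.le, ← Real.rpow_mul hη.le]
    have e1 : -κ⁻¹ * (γ - 1) = -α := by rw [hγκ]; field_simp; ring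
    have e2 : -κ⁻¹ * -κ = 1 := by field_simp
    rw [e1, e2, Real.rpow_one]
  -- `2 T` is the contribution of `|x| > R`, so the difference is that of `|x| ≤ R`: nonnegative and
  -- bounded by the negligible term.
  suffices h : Tendsto (fun η => deficit q f η / |η| ^ α - 2 * T η) (𝓝[≠] 0) (𝓝 0) by
    simpa using h.add hT1
  have hdec : ∀ η ≠ 0, deficit q f η / |η| ^ α - 2 * T η = 2 * |η| ^ (-α) * ∫ x in Set.Ioi 0,
      (f x * qVers q (x * |η| * f x ^ (q - 1)) -
        (Set.Ioi R).indicator (fun x => f x * qVers q (x * |η| * f x ^ (q - 1))) x) := by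
    intro η hη
    have hi := (integrable_deficit hq hf |η|)
    rw [integral_sub hi.integrableOn (hi.indicator measurableSet_Ioi).integrableOn, hT,
      ← deficit_abs, deficit_eq_two_mul q hsymm, Real.rpow_neg (abs_nonneg η)]
    ring
  refine squeeze_zero' ?_ ?_ hsmall
  · filter_upwards [self_mem_nhdsWithin] with η hη
    rw [hdec η hη]
    refine mul_nonneg (by positivity) (integral_nonneg fun x => ?_)
    simp only [Set.indicator, Pi.zero_apply]
    have := mul_nonneg (hf.nonneg x) (qVers_nonneg hq (x * |η| * f x ^ (q - 1)))
    split_ifs <;> simp [this]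
  · filter_upwards [self_mem_nhdsWithin] with η hη
    have hη : 0 < |η| := abs_pos.2 hη
    rw [hdec η (abs_pos.1 hη), Real.rpow_sub hη, Real.rpow_neg hη.le, Real.rpow_two]
    have hle : ∫ x in Set.Ioi 0, (f x * qVers q (x * |η| * f x ^ (q - 1)) -
        (Set.Ioi R).indicator (fun x => f x * qVers q (x * |η| * f x ^ (q - 1))) x) ≤
        ∫ x, K * R ^ 2 * |η| ^ 2 * f x ^ (2 * q - 1) := by
      have hi := (integrable_deficit hq hf |η|)
      refine (setIntegral_mono_on
        (hi.integrableOn.sub (hi.indicator measurableSet_Ioi).integrableOn)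
        (hν.const_mul (K * R ^ 2 * |η| ^ 2)).integrableOn measurableSet_Ioi fun x hx => ?_).trans
        (setIntegral_le_integral (hν.const_mul (K * R ^ 2 * |η| ^ 2))
          (Eventually.of_forall fun x => ?_))
      · have hx : 0 < x := hx
        have hfp : 0 ≤ f x ^ (2 * q - 1) := Real.rpow_nonneg (hf.nonneg x) _
        rw [Pi.sub_apply]
        by_cases h : x ∈ Set.Ioi R
        · rw [Set.indicator_of_mem h, sub_self]; positivity
        · have hxR : x ≤ R := not_lt.1 h
          rw [Set.indicator_of_notMem h, sub_zero]
          refine (mul_le_mul_of_nonneg_left (hKw _) (hf.nonneg x)).trans ?_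
          calc f x * (K * (x * |η| * f x ^ (q - 1)) ^ 2)
              = K * x ^ 2 * |η| ^ 2 * (f x * (f x ^ (q - 1)) ^ 2) := by ring
            _ = K * x ^ 2 * |η| ^ 2 * f x ^ (2 * q - 1) := by rw [mul_rpow_sq hq (hf.nonneg x)]
            _ ≤ _ := by gcongr
      · have hfp : 0 ≤ f x ^ (2 * q - 1) := Real.rpow_nonneg (hf.nonneg x) _
        simp only [Pi.zero_apply]
        positivity
    rw [integral_const_mul] at hle
    have := mul_le_mul_of_nonneg_left hle (show 0 ≤ 2 * (|η| ^ α)⁻¹ by positivity)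
    refine this.trans_eq ?_
    field_simp

/-! ### The scaling constant, `q`-logarithms and normalized sums -/

section RandomVariables

lemma IsDensity.not_ae_eq_zero {f : ℝ → ℝ} (hf : IsDensity f) : ¬ f =ᵐ[volume] 0 := by
  intro h
  have := hf.integral_eq_one
  rw [integral_congr_ae h] at this
  simp at this

lemma integral_mul_rpow_pos {f : ℝ → ℝ} (hf : IsDensity f) {p : ℝ} {w : ℝ → ℝ}
    (hw : ∀ x, x ≠ 0 → 0 < w x) (hw0 : 0 ≤ w 0) (hi : Integrable fun x => w x * f x ^ p) :
    0 < ∫ x, w x * f x ^ p := by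
  have hnn : ∀ x, 0 ≤ w x * f x ^ p := fun x => by
    refine mul_nonneg ?_ (Real.rpow_nonneg (hf.nonneg x) _)
    by_cases h : x = 0
    · rwa [h]
    · exact (hw x h).le
  refine lt_of_le_of_ne (integral_nonneg hnn) fun h => hf.not_ae_eq_zero ?_
  have h0 := (integral_eq_zero_iff_of_nonneg hnn hi).1 h.symm
  have hne : ∀ᵐ x : ℝ, x ≠ 0 := Measure.ae_ne volume 0
  filter_upwards [h0, hne] with x hx hx0
  have hx' : f x ^ p = 0 := (mul_eq_zero.1 hx).resolve_left (hw x hx0).ne'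
  exact ((Real.rpow_eq_zero_iff_of_nonneg (hf.nonneg x)).1 hx').1

/-- Unites the two regimes; the convergence proof uses nothing else about `f` than this expansion,
symmetry and being a density. -/
lemma mu_pos_and_tendsto {q α : ℝ} (hq : 1 ≤ q) (hq2 : q < 2) (h0 : 0 < α) {f : ℝ → ℝ}
    (hf : IsDensity f) (hsymm : ∀ x, f (-x) = f x) (hcond : StableCondition q α f) :
    0 < mu q α f ∧
      Tendsto (fun η => deficit q f η / |η| ^ α) (𝓝[≠] 0) (𝓝 (mu q α f)) := by
  obtain ⟨hν, ⟨hα, hσ⟩ | ⟨hα, C, hC, htail⟩⟩ := hcond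
  -- `ν ≠ 0` is needed to undo the division hidden in the variance.
  · have hν0 : nu (2 * q - 1) f ≠ 0 := by
      have := integral_mul_rpow_pos hf (w := fun _ => 1) (fun _ _ => one_pos) zero_le_one
        (p := 2 * q - 1) (by simpa using hν)
      simp only [one_mul] at this
      exact this.ne'
    have hσ0 := integral_mul_rpow_pos hf (w := fun x => x ^ 2) (fun x hx => by positivity)
      (by simp) hσ
    have hmu : mu q α f = q / 2 * ∫ x, x ^ 2 * f x ^ (2 * q - 1) := by
      rw [mu, if_pos hα, qVariance, mul_assoc, div_mul_cancel₀ _ hν0]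
    rw [hmu]
    refine ⟨by positivity, (tendsto_deficit_div_sq hq hf hσ).congr fun η => ?_⟩
    rw [hα, Real.rpow_two, sq_abs]
  · have hmu : mu q α f = 2 ^ (1 - α) * (1 + α * (q - 1)) / (2 - q) * C ^ (1 + α * (q - 1)) *
        ∫ y in Set.Ioi (0 : ℝ), -qPsi q y / y ^ (α + 1) := by
      rw [mu, if_neg hα.ne, tailConst, htail.limUnder_eq]
    rw [hmu]
    refine ⟨?_, tendsto_deficit_div_rpow hq hq2 h0 hα hf hsymm hν hC htail⟩
    have h1 := integral_qPsi_pos hq h0 hα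
    have h2 : 0 < 1 + α * (q - 1) := by nlinarith
    have h3 : 0 < 2 - q := by linarith
    positivity

/-- The real `q`-logarithm. -/
def qLog (q z : ℝ) : ℝ := if q = 1 then Real.log z else (z ^ (1 - q) - 1) / (1 - q)

lemma qLog_one (q : ℝ) : qLog q 1 = 0 := by
  simp [qLog]

lemma hasDerivAt_qLog (q : ℝ) : HasDerivAt (qLog q) 1 1 := by
  by_cases h : q = 1
  · have e : qLog q = Real.log := by ext z; simp [qLog, h]
    rw [e]
    simpa using Real.hasDerivAt_log one_ne_zero
  · have e : qLog q = fun z => (z ^ (1 - q) - 1) / (1 - q) := by ext z; simp [qLog, h]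
    rw [e]
    have h1 : 1 - q ≠ 0 := sub_ne_zero.2 (Ne.symm h)
    have := ((Real.hasDerivAt_rpow_const (x := 1) (p := 1 - q) (Or.inl one_ne_zero)).sub_const
      1).div_const (1 - q)
    simpa [h1] using this

/-- The `q`-logarithm makes the `q`-product additive. For `q > 1` and `0 < z ≤ 1` one has `z^{1-q} ≥
1`, so every base is a positive real: neither the truncation in `qExp` nor the branch of the complex
powers interferes. -/
lemma qProdUpTo_const {q : ℝ} (hq : 1 ≤ q) {z : ℝ} (hz0 : 0 < z) (hz1 : z ≤ 1) (n : ℕ) :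
    qProdUpTo q (fun _ => (z : ℂ)) n = (qExp q ((n + 1 : ℕ) * qLog q z) : ℂ) := by
  by_cases h : q = 1
  · have e : ∀ n : ℕ, qExp q ((n + 1 : ℕ) * qLog q z) = z ^ (n + 1) := fun n => by
      simp only [qExp, qLog, h, if_true]
      rw [← Real.log_pow, Real.exp_log (by positivity)]
    rw [e]
    induction n with
    | zero => simp [qProdUpTo]
    | succ n ih => rw [qProdUpTo, ih, qProd, if_pos h]; push_cast; ring
  · have hq' : 1 < q := lt_of_le_of_ne hq (Ne.symm h)
    have h1 : 1 - q ≠ 0 := sub_ne_zero.2 (Ne.symm h)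
    have hz : 1 ≤ z ^ (1 - q) :=
      Real.one_le_rpow_of_pos_of_le_one_of_nonpos hz0 hz1 (by linarith)
    have hpos : ∀ n : ℕ, 0 ≤ 1 + (n + 1 : ℕ) * (z ^ (1 - q) - 1) := fun n => by
      have : (0:ℝ) ≤ (n + 1 : ℕ) * (z ^ (1 - q) - 1) :=
        mul_nonneg (Nat.cast_nonneg _) (by linarith)
      linarith
    have e : ∀ n : ℕ, qExp q ((n + 1 : ℕ) * qLog q z) =
        (1 + (n + 1 : ℕ) * (z ^ (1 - q) - 1)) ^ (1 / (1 - q)) := fun n => by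
      simp only [qExp, qLog, h, if_false]
      rw [show 1 + (1 - q) * ((n + 1 : ℕ) * ((z ^ (1 - q) - 1) / (1 - q))) =
        1 + (n + 1 : ℕ) * (z ^ (1 - q) - 1) by field_simp, max_eq_right (hpos n)]
    rw [e]
    induction n with
    | zero =>
      simp only [qProdUpTo, zero_add, Nat.cast_one, one_mul, add_sub_cancel]
      rw [← Real.rpow_mul hz0.le, mul_one_div_cancel h1, Real.rpow_one]
    | succ n ih =>
      rw [qProdUpTo, ih, qProd, if_neg h]
      have c1 : (1 - (q : ℂ)) = ((1 - q : ℝ) : ℂ) := by push_cast; rfl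
      have c2 : (1 / (((1 - q : ℝ) : ℂ))) = ((1 / (1 - q) : ℝ) : ℂ) := by push_cast; rfl
      rw [c1, ← Complex.ofReal_cpow (Real.rpow_nonneg (hpos n) _), ← Complex.ofReal_cpow hz0.le, c2,
        ← Real.rpow_mul (hpos n), one_div_mul_cancel h1, Real.rpow_one]
      rw [← Complex.ofReal_one, ← Complex.ofReal_add, ← Complex.ofReal_sub,
        show 1 + (n + 1 : ℕ) * (z ^ (1 - q) - 1) + z ^ (1 - q) - 1 =
          1 + (n + 1 + 1 : ℕ) * (z ^ (1 - q) - 1) by push_cast; ring, Complex.ofReal_cpow (hpos _)]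

/-- For `x ≤ 0` the base is at least `1`, away from the truncation. -/
lemma continuousAt_qExp {q : ℝ} (hq : 1 ≤ q) {x : ℝ} (hx : x ≤ 0) : ContinuousAt (qExp q) x := by
  by_cases h : q = 1
  · have e : qExp q = Real.exp := by ext z; simp [qExp, h]
    rw [e]
    exact Real.continuous_exp.continuousAt
  · have e : qExp q = fun x => (max 0 (1 + (1 - q) * x)) ^ (1 / (1 - q)) := by
      ext z; simp [qExp, h]
    rw [e]
    have : 0 < max 0 (1 + (1 - q) * x) := lt_max_of_lt_right (by nlinarith)
    exact ContinuousAt.rpow_const (by fun_prop) (Or.inl this.ne')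

lemma deficit_zero (q : ℝ) (f : ℝ → ℝ) : deficit q f 0 = 0 := by
  simp [deficit, qVers_zero]

lemma tendsto_deficit_zero {q α : ℝ} (h0 : 0 < α) {f : ℝ → ℝ} {m : ℝ}
    (hm : Tendsto (fun η => deficit q f η / |η| ^ α) (𝓝[≠] 0) (𝓝 m)) :
    Tendsto (deficit q f) (𝓝 0) (𝓝 0) := by
  have h1 : Tendsto (fun η : ℝ => |η| ^ α) (𝓝[≠] 0) (𝓝 0) := by
    have := ((continuous_abs (G := ℝ)).tendsto 0).rpow_const (p := α) (Or.inr h0.le)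
    rw [abs_zero, Real.zero_rpow h0.ne'] at this
    exact this.mono_left nhdsWithin_le_nhds
  have h2 := hm.mul h1
  rw [mul_zero] at h2
  have h3 : Tendsto (deficit q f) (𝓝[≠] 0) (𝓝 (deficit q f 0)) := by
    rw [deficit_zero]
    refine h2.congr' ?_
    filter_upwards [self_mem_nhdsWithin] with η hη
    have : 0 < |η| ^ α := Real.rpow_pos_of_pos (abs_pos.2 hη) _
    field_simp
  have := continuousAt_iff_punctured_nhds.2 h3
  rw [ContinuousAt, deficit_zero] at this
  exact this

/-- First order expansion of the `q`-logarithm of the transform at the origin. -/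
lemma exists_qLog_one_sub_deficit {q α : ℝ} (h0 : 0 < α) {f : ℝ → ℝ} {m : ℝ}
    (hm : Tendsto (fun η => deficit q f η / |η| ^ α) (𝓝[≠] 0) (𝓝 m)) :
    ∃ ρ : ℝ → ℝ, Tendsto ρ (𝓝 0) (𝓝 (-m)) ∧
      ∀ η, qLog q (1 - deficit q f η) = ρ η * |η| ^ α := by
  classical
  -- The value `-m` at `0` makes `ρ` continuous there. It must be defined at `0` because `ξ = 0`
  -- gives `η = 0`.
  refine ⟨Function.update (fun η => qLog q (1 - deficit q f η) / |η| ^ α) 0 (-m), ?_, ?_⟩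
  · have h : Tendsto (fun η => qLog q (1 - deficit q f η) / |η| ^ α) (𝓝[≠] 0) (𝓝 (-m)) := by
      have hd := (tendsto_deficit_zero h0 hm).mono_left (nhdsWithin_le_nhds (s := {0}ᶜ))
      have hlo := (hasDerivAt_iff_isLittleO.1 (hasDerivAt_qLog q))
      have hd1 : Tendsto (fun η => 1 - deficit q f η) (𝓝[≠] 0) (𝓝 1) := by
        simpa using hd.const_sub 1
      have h1 := hlo.comp_tendsto hd1
      have hO : (fun η => 1 - deficit q f η - 1) =O[𝓝[≠] 0] fun η => |η| ^ α := by
        have : (deficit q f) =O[𝓝[≠] 0] fun η => |η| ^ α := by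
          refine isBigO_of_div_tendsto_nhds ?_ m hm
          filter_upwards [self_mem_nhdsWithin] with η hη h
          exact absurd h (Real.rpow_pos_of_pos (abs_pos.2 hη) _).ne'
        simpa [sub_sub_cancel_left] using this.neg_left
      have h2 := (h1.trans_isBigO hO).tendsto_div_nhds_zero
      have h3 := h2.sub hm
      rw [zero_sub] at h3
      refine h3.congr fun η => ?_
      simp only [Function.comp, qLog_one, smul_eq_mul]
      ring
    have : ContinuousAt (Function.update (fun η => qLog q (1 - deficit q f η) / |η| ^ α) 0 (-m)) 0 :=
      continuousAt_update_same.2 h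
    simpa [ContinuousAt] using this
  · intro η
    by_cases hη : η = 0
    · simp [hη, deficit_zero, qLog_one, Real.zero_rpow h0.ne']
    · have : 0 < |η| ^ α := Real.rpow_pos_of_pos (abs_pos.2 hη) _
      rw [Function.update_of_ne hη]
      field_simp

lemma map_mul_left_withDensity {a : ℝ} (ha : 0 < a) {p : ℝ → ENNReal} (hp : Measurable p) :
    (volume.withDensity p).map (fun x => a * x) =
      volume.withDensity fun x => ENNReal.ofReal a⁻¹ * p (a⁻¹ * x) := by
  ext A hA
  have hm : Measurable fun x : ℝ => a * x := measurable_const.mul measurable_id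
  have hm' : Measurable fun x : ℝ => ENNReal.ofReal a⁻¹ * p (a⁻¹ * x) :=
    measurable_const.mul (hp.comp (measurable_const.mul measurable_id))
  rw [Measure.map_apply hm hA, withDensity_apply _ (hm hA), withDensity_apply _ hA]
  conv_rhs => rw [← Real.smul_map_volume_mul_left ha.ne']
  rw [Measure.restrict_smul, lintegral_smul_measure, setLIntegral_map hA hm' hm,
    lintegral_const_mul _ (by fun_prop), smul_eq_mul, ← mul_assoc, abs_of_pos ha,
    ← ENNReal.ofReal_mul ha.le, mul_inv_cancel₀ ha.ne', ENNReal.ofReal_one, one_mul]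
  refine lintegral_congr fun x => ?_
  rw [inv_mul_cancel_left₀ ha.ne']

lemma normSum_eq {Ω : Type*} (q α m : ℝ) (X : ℕ → Ω → ℝ) (N : ℕ) :
    normSum q α m X N = fun ω => ((m * N) ^ (1 / (α * (2 - q))))⁻¹ *
      ∑ i ∈ Finset.range N, X i ω := by
  ext ω
  rw [normSum, div_eq_inv_mul]

variable {Ω : Type*} [MeasurableSpace Ω]

lemma hasPDF_mul_left {P : Measure Ω} [IsProbabilityMeasure P] {S : Ω → ℝ}
    (hS : HasPDF S P volume) {a : ℝ} (ha : 0 < a) :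
    HasPDF (fun ω => a * S ω) P volume ∧
      pdf (fun ω => a * S ω) P volume =ᵐ[volume]
        fun x => ENNReal.ofReal a⁻¹ * pdf S P volume (a⁻¹ * x) := by
  have hm : Measurable fun x : ℝ => a * x := measurable_const.mul measurable_id
  have hp := measurable_pdf S P volume
  have hm' : AEMeasurable (fun x : ℝ => ENNReal.ofReal a⁻¹ * pdf S P volume (a⁻¹ * x)) volume :=
    (measurable_const.mul (hp.comp (measurable_const.mul measurable_id))).aemeasurable
  have hSm : AEMeasurable S P := HasPDF.aemeasurable S P volume
  have hmap : P.map (fun ω => a * S ω) =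
      volume.withDensity fun x => ENNReal.ofReal a⁻¹ * pdf S P volume (a⁻¹ * x) := by
    rw [← map_mul_left_withDensity ha hp, ← map_eq_withDensity_pdf S P volume,
      AEMeasurable.map_map_of_aemeasurable hm.aemeasurable hSm]
    rfl
  have h1 : HasPDF (fun ω => a * S ω) P volume :=
    hasPDF_of_map_eq_withDensity (hm.comp_aemeasurable hSm) _ hm' hmap
  exact ⟨h1, (pdf.eq_of_map_eq_withDensity _ hm').1 hmap⟩

lemma qFourier_congr_ae (q : ℝ) {f g : ℝ → ℝ} (h : f =ᵐ[volume] g) (ξ : ℝ) :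
    qFourier q f ξ = qFourier q g ξ := by
  refine integral_congr_ae ?_
  filter_upwards [h] with x hx
  rw [hx]

/-- In `x ξ (c f(cx))^{q-1} = (cx) · (c^{q-2} ξ) · f(cx)^{q-1}` one power of `c` is absorbed by the
variable. This is why the normalization carries the exponent `1/(α(2-q))`. -/
lemma qFourier_mul_comp_mul (q : ℝ) {f : ℝ → ℝ} (hf : ∀ x, 0 ≤ f x) {c : ℝ} (hc : 0 < c) (ξ : ℝ) :
    qFourier q (fun x => c * f (c * x)) ξ = qFourier q f (ξ * c ^ (q - 2)) := by
  unfold qFourier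
  have := Measure.integral_comp_mul_left
    (fun x => (f x : ℂ) * qCExp q (Complex.I * ((x * (ξ * c ^ (q - 2)) * f x ^ (q - 1) : ℝ) : ℂ))) c
  rw [abs_of_pos (inv_pos.2 hc)] at this
  rw [(inv_smul_eq_iff₀ hc.ne').1 this.symm, ← integral_smul]
  congr 1
  ext x
  rw [Real.mul_rpow hc.le (hf _), show q - 1 = (q - 2) + 1 by ring, Real.rpow_add_one hc.ne',
    Complex.real_smul, Complex.ofReal_mul, mul_assoc]
  congr 5
  ring

lemma qFourierRV_mul_left (q : ℝ) {P : Measure Ω} [IsProbabilityMeasure P] {S : Ω → ℝ}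
    (hS : HasPDF S P volume) {a : ℝ} (ha : 0 < a) (ξ : ℝ) :
    qFourierRV q P (fun ω => a * S ω) ξ = qFourierRV q P S (ξ * a ^ (2 - q)) := by
  rw [qFourierRV, qFourierRV]
  have h : (fun x => (pdf (fun ω => a * S ω) P volume x).toReal) =ᵐ[volume]
      fun x => a⁻¹ * (pdf S P volume (a⁻¹ * x)).toReal := by
    filter_upwards [(hasPDF_mul_left hS ha).2] with x hx
    rw [hx, ENNReal.toReal_mul, ENNReal.toReal_ofReal (inv_pos.2 ha).le]
  rw [qFourier_congr_ae q h, qFourier_mul_comp_mul q (f := fun x => (pdf S P volume x).toReal)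
    (fun x => ENNReal.toReal_nonneg) (inv_pos.2 ha), Real.inv_rpow ha.le, ← Real.rpow_neg ha.le,
    neg_sub]

lemma hasPDF_of_map_eq {P : Measure Ω} {X : Ω → ℝ} (hX : Measurable X) {f : ℝ → ℝ}
    (hf : IsDensity f) (hlaw : P.map X = volume.withDensity (fun x => ENNReal.ofReal (f x))) :
    HasPDF X P volume :=
  hasPDF_of_map_eq_withDensity hX.aemeasurable _ hf.measurable.ennreal_ofReal.aemeasurable hlaw

lemma qFourierRV_of_map_eq {P : Measure Ω} [IsProbabilityMeasure P] {X : Ω → ℝ} (hX : Measurable X)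
    {f : ℝ → ℝ} (hf : IsDensity f)
    (hlaw : P.map X = volume.withDensity (fun x => ENNReal.ofReal (f x))) (q ξ : ℝ) :
    qFourierRV q P X ξ = qFourier q f ξ := by
  have := hasPDF_of_map_eq hX hf hlaw
  refine qFourier_congr_ae q ?_ ξ
  filter_upwards [(pdf.eq_of_map_eq_withDensity _
    hf.measurable.ennreal_ofReal.aemeasurable).1 hlaw] with x hx
  rw [hx, ENNReal.toReal_ofReal (hf.nonneg x)]

lemma hasPDF_sum {P : Measure Ω} {q : ℝ} {X : ℕ → Ω → ℝ} (hX : ∀ i, Measurable (X i)) {f : ℝ → ℝ}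
    (hf : IsDensity f)
    (hlaw : ∀ i, P.map (X i) = volume.withDensity (fun x => ENNReal.ofReal (f x)))
    (hindep : QIndep q P X) {N : ℕ} (hN : 1 ≤ N) :
    HasPDF (fun ω => ∑ i ∈ Finset.range N, X i ω) P volume := by
  obtain ⟨n, rfl⟩ := Nat.exists_eq_add_of_le' hN
  -- `QIndep` speaks of at least two summands; a single one has the density `f`.
  rcases Nat.eq_zero_or_pos n with rfl | hn
  · simpa using hasPDF_of_map_eq (hX 0) hf (hlaw 0)
  · exact (hindep n hn).1

lemma hasPDF_normSum {P : Measure Ω} [IsProbabilityMeasure P] {q α m : ℝ} (hm : 0 < m)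
    {X : ℕ → Ω → ℝ} (hX : ∀ i, Measurable (X i)) {f : ℝ → ℝ} (hf : IsDensity f)
    (hlaw : ∀ i, P.map (X i) = volume.withDensity (fun x => ENNReal.ofReal (f x)))
    (hindep : QIndep q P X) {N : ℕ} (hN : 1 ≤ N) :
    HasPDF (normSum q α m X N) P volume := by
  rw [normSum_eq]
  have hN' : (0 : ℝ) < N := by exact_mod_cast hN
  exact (hasPDF_mul_left (hasPDF_sum hX hf hlaw hindep hN) (by positivity)).1

lemma tendstoLocallyUniformly_normSum {P : Measure Ω} [IsProbabilityMeasure P] {q α : ℝ}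
    (hq : 1 ≤ q) (hq2 : q < 2) (h0 : 0 < α)
    {X : ℕ → Ω → ℝ} (hX : ∀ i, Measurable (X i)) {f : ℝ → ℝ} (hf : IsDensity f)
    (hsymm : ∀ x, f (-x) = f x)
    (hlaw : ∀ i, P.map (X i) = volume.withDensity (fun x => ENNReal.ofReal (f x)))
    (hcond : StableCondition q α f) (hindep : QIndep q P X) :
    TendstoLocallyUniformly
      (fun (N : ℕ) (ξ : ℝ) => qFourierRV q P (normSum q α (mu q α f) X N) ξ)
      (fun ξ : ℝ => (qExp q (-(|ξ| ^ α)) : ℂ)) atTop := by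
  obtain ⟨hm0, hm⟩ := mu_pos_and_tendsto hq hq2 h0 hf hsymm hcond
  set m := mu q α f
  obtain ⟨ρ, hρ, hρe⟩ := exists_qLog_one_sub_deficit h0 hm
  have hdef := tendsto_deficit_zero h0 hm
  rw [tendstoLocallyUniformly_iff_forall_tendsto]
  intro ξ₀
  set η : ℕ × ℝ → ℝ := fun y => y.2 * (m * y.1) ^ (-(1 / α)) with hη
  have hcont : ContinuousAt (fun ξ : ℝ => (qExp q (-(|ξ| ^ α)) : ℂ)) ξ₀ := by
    refine Complex.continuous_ofReal.continuousAt.comp ?_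
    have : ContinuousAt (fun ξ : ℝ => -(|ξ| ^ α)) ξ₀ :=
      (continuous_abs.continuousAt.rpow_const (Or.inr h0.le)).neg
    exact ContinuousAt.comp (f := fun ξ : ℝ => -(|ξ| ^ α)) (g := qExp q)
      (continuousAt_qExp hq (by simp; positivity)) this
  have hηt : Tendsto η (atTop ×ˢ 𝓝 ξ₀) (𝓝 0) := by
    have h1 : Tendsto (fun N : ℕ => (m * N) ^ (-(1 / α))) atTop (𝓝 0) :=
      (tendsto_rpow_neg_atTop (by positivity)).comp
        (tendsto_natCast_atTop_atTop.const_mul_atTop hm0)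
    have := (tendsto_snd (f := atTop) (g := 𝓝 ξ₀)).mul (h1.comp tendsto_fst)
    rw [mul_zero] at this
    exact this
  have hval : ∀ᶠ y : ℕ × ℝ in atTop ×ˢ 𝓝 ξ₀, qFourierRV q P (normSum q α m X y.1) y.2 =
      (qExp q (ρ (η y) * |y.2| ^ α / m) : ℂ) := by
    have h1 : ∀ᶠ y : ℕ × ℝ in atTop ×ˢ 𝓝 ξ₀, 2 ≤ y.1 :=
      tendsto_fst.eventually (eventually_ge_atTop 2)
    -- This makes the common factor `1 - D(η)` positive, so the product formula is available.
    have h2 : ∀ᶠ y : ℕ × ℝ in atTop ×ˢ 𝓝 ξ₀, deficit q f (η y) < 1 :=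
      (hdef.comp hηt).eventually (gt_mem_nhds one_pos)
    filter_upwards [h1, h2] with ⟨N, ξ⟩ hN hd
    simp only at hN
    have hN0 : (0 : ℝ) < N := by exact_mod_cast (by omega : 0 < N)
    have hmN : 0 < m * N := by positivity
    have hα' : α * (2 - q) ≠ 0 := mul_ne_zero h0.ne' (by linarith)
    have e1 : (((m * N) ^ (1 / (α * (2 - q))))⁻¹) ^ (2 - q) = (m * N) ^ (-(1 / α)) := by
      rw [← Real.rpow_neg hmN.le, ← Real.rpow_mul hmN.le]
      congr 1
      have : 2 - q ≠ 0 := by linarith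
      field_simp
    obtain ⟨n, rfl⟩ := Nat.exists_eq_add_of_le' (show 1 ≤ N by omega)
    have hS := hindep n (by omega)
    rw [normSum_eq, qFourierRV_mul_left q hS.1 (by positivity), e1]
    have hX' : ∀ i, qFourierRV q P (X i) (η (n + 1, ξ)) =
        ((1 - deficit q f (η (n + 1, ξ)) : ℝ) : ℂ) := fun i => by
      rw [qFourierRV_of_map_eq (hX i) hf (hlaw i), qFourier_eq_one_sub_deficit hq hf hsymm]
    have hz : 0 < 1 - deficit q f (η (n + 1, ξ)) := by linarith
    have := hS.2 (η (n + 1, ξ)) fun _ i _ => by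
      rw [hX']; exact Complex.ofReal_mem_slitPlane.2 hz
    rw [show (fun i => qFourierRV q P (X i) (η (n + 1, ξ))) =
      fun _ => ((1 - deficit q f (η (n + 1, ξ)) : ℝ) : ℂ) from funext hX',
      qProdUpTo_const hq hz (by linarith [deficit_nonneg hq hf (η (n + 1, ξ))]), hρe] at this
    refine this.trans ?_
    congr 2
    have e2 : |η (n + 1, ξ)| ^ α = |ξ| ^ α * (m * (n + 1 : ℕ))⁻¹ := by
      simp only [hη]
      rw [abs_mul, Real.mul_rpow (abs_nonneg _) (abs_nonneg _),
        abs_of_pos (Real.rpow_pos_of_pos hmN _), ← Real.rpow_mul hmN.le,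
        show -(1 / α) * α = -1 by field_simp, Real.rpow_neg_one]
    rw [e2]
    field_simp
  have hlim : Tendsto (fun y : ℕ × ℝ => (qExp q (ρ (η y) * |y.2| ^ α / m) : ℂ)) (atTop ×ˢ 𝓝 ξ₀)
      (𝓝 (qExp q (-(|ξ₀| ^ α)) : ℂ)) := by
    refine (Complex.continuous_ofReal.tendsto _).comp ?_
    refine (continuousAt_qExp hq (by simp; positivity)).tendsto.comp ?_
    have h1 : Tendsto (fun y : ℕ × ℝ => |y.2| ^ α) (atTop ×ˢ 𝓝 ξ₀) (𝓝 (|ξ₀| ^ α)) :=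
      (tendsto_snd.abs).rpow_const (Or.inr h0.le)
    have := ((hρ.comp hηt).mul h1).div_const m
    rw [show -(|ξ₀| ^ α) = -m * |ξ₀| ^ α / m by field_simp]
    exact this
  -- The limit function and the transforms both tend to the limit value at `ξ₀`, so the pair
  -- eventually lies in every entourage.
  exact ((hcont.tendsto.comp tendsto_snd).prodMk_nhds
    (hlim.congr' (hval.mono fun y hy => hy.symm))).mono_right (nhds_le_uniformity _)

end RandomVariables

/-! ### Integrability and tails of `(1 + a|x|^α)^e` -/

lemma integrable_comp_abs_of_integrableOn {f : ℝ → ℝ} (hf : IntegrableOn f (Set.Ioi 0)) :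
    Integrable fun x => f |x| := by
  have hpos : IntegrableOn (fun x => f |x|) (Set.Ioi 0) :=
    hf.congr_fun (fun x hx => by rw [abs_of_pos hx]) measurableSet_Ioi
  have hneg : IntegrableOn (fun x => f |x|) (Set.Iic 0) := by
    rw [← Measure.map_neg_eq_self (volume : Measure ℝ)]
    have m : MeasurableEmbedding fun x : ℝ => -x := (Homeomorph.neg ℝ).measurableEmbedding
    rw [m.integrableOn_map_iff]
    simp_rw [Function.comp_def, abs_neg, Set.neg_preimage, Set.neg_Iic, neg_zero]
    exact Iff.mpr integrableOn_Ici_iff_integrableOn_Ioi hpos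
  rw [← integrableOn_univ, ← Set.Iic_union_Ioi (a := (0 : ℝ))]
  exact hneg.union hpos

lemma integrable_one_add_rpow {a α e : ℝ} (ha : 0 < a) (hα : 0 < α) (he : α * e < -1) :
    Integrable fun x : ℝ => (1 + a * |x| ^ α) ^ e := by
  have he0 : e < 0 := by by_contra h; nlinarith [mul_nonneg hα.le (not_lt.1 h)]
  -- The majorant is `1` for `|x| ≤ 1` and `a^e |x|^{αe}` beyond, both up to the factor `1 + a^e`.
  have hb := integrable_comp_abs_of_integrableOn ((integrableOn_ite_rpow (a := 0) (by norm_num) he).const_mul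
    (1 + a ^ e))
  refine hb.mono' ?_ (Eventually.of_forall fun x => ?_)
  · exact (by fun_prop : Measurable fun x : ℝ => (1 + a * |x| ^ α) ^ e).aestronglyMeasurable
  · have h1 : 0 ≤ a * |x| ^ α := by positivity
    have h2 : 0 < a ^ e := Real.rpow_pos_of_pos ha e
    rw [Real.norm_of_nonneg (by positivity)]
    split_ifs with h
    · rw [Real.rpow_zero, mul_one]
      have := Real.rpow_le_one_of_one_le_of_nonpos (show 1 ≤ 1 + a * |x| ^ α by linarith) he0.le
      linarith
    · have hx : 0 < |x| := by linarith
      have h3 : 0 < a * |x| ^ α := by positivity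
      calc (1 + a * |x| ^ α) ^ e ≤ (a * |x| ^ α) ^ e :=
            Real.rpow_le_rpow_of_nonpos h3 (by linarith) he0.le
        _ = a ^ e * |x| ^ (α * e) := by
            rw [Real.mul_rpow ha.le (by positivity), ← Real.rpow_mul hx.le]
        _ ≤ _ := by gcongr; linarith

lemma isEquivalent_one_add_rpow {a α e : ℝ} (ha : 0 < a) (hα : 0 < α) :
    (fun x : ℝ => (1 + a * |x| ^ α) ^ e) ~[cocompact ℝ] fun x => a ^ e * |x| ^ (α * e) := by
  have h0 : ∀ᶠ x : ℝ in cocompact ℝ, 0 < |x| := by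
    have := tendsto_norm_cocompact_atTop (E := ℝ)
    exact this.eventually_gt_atTop 0
  refine (isEquivalent_iff_tendsto_one ?_).2 ?_
  · filter_upwards [h0] with x hx
    positivity
  · have h1 : Tendsto (fun x : ℝ => |x| ^ (-α)) (cocompact ℝ) (𝓝 0) :=
      (tendsto_rpow_neg_atTop hα).comp (tendsto_norm_cocompact_atTop (E := ℝ))
    have h2 : Tendsto (fun x : ℝ => (a⁻¹ * |x| ^ (-α) + 1) ^ e) (cocompact ℝ) (𝓝 1) := by
      have := ((h1.const_mul a⁻¹).add_const 1).rpow_const (p := e) (Or.inl (by simp))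
      simpa using this
    refine h2.congr' ?_
    filter_upwards [h0] with x hx
    have hxα : 0 < |x| ^ α := by positivity
    simp only [Pi.div_apply]
    rw [Real.rpow_mul hx.le, ← Real.mul_rpow ha.le hxα.le,
      ← Real.div_rpow (by positivity) (by positivity), Real.rpow_neg hx.le]
    congr 1
    field_simp

lemma ofReal_mul_cpow {r : ℝ} (hr : 0 < r) {z : ℂ} (hz : z ≠ 0) (c : ℂ) :
    ((r : ℂ) * z) ^ c = (r : ℂ) ^ c * z ^ c := by
  have hr' : (r : ℂ) ≠ 0 := by exact_mod_cast hr.ne'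
  rw [Complex.cpow_def_of_ne_zero (mul_ne_zero hr' hz), Complex.cpow_def_of_ne_zero hr',
    Complex.cpow_def_of_ne_zero hz, Complex.log_ofReal_mul hr hz, ← Complex.exp_add,
    Complex.ofReal_log hr.le]
  ring_nf

/-! ### A contour shift -/

section Contour

variable {a B e : ℝ}

lemma quadratic_re (a B x v : ℝ) :
    ((a : ℂ) * ((x : ℂ) + v * Complex.I) ^ 2 + B).re = a * (x ^ 2 - v ^ 2) + B := by
  simp [sq]

/-- On the strip `|v| ≤ |y|` the quadratic has real part at least `1 + a x²`. This keeps it off the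
branch cut and bounds its negative powers uniformly in `v`. -/
lemma norm_quadratic_cpow_le (ha : 0 < a) (he : e < 0) {y x v : ℝ} (hv : v ^ 2 ≤ y ^ 2) :
    ‖((a : ℂ) * ((x : ℂ) + v * Complex.I) ^ 2 + (1 + a * y ^ 2 : ℝ)) ^ (e : ℂ)‖ ≤
      (1 + a * x ^ 2) ^ e := by
  rw [Complex.norm_cpow_real]
  refine Real.rpow_le_rpow_of_nonpos (by positivity) ?_ he.le
  refine le_trans ?_ ((le_abs_self _).trans (Complex.abs_re_le_norm _))
  rw [quadratic_re]
  nlinarith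

lemma quadratic_mem_slitPlane (ha : 0 < a) {y x v : ℝ} (hv : v ^ 2 ≤ y ^ 2) :
    (a : ℂ) * ((x : ℂ) + v * Complex.I) ^ 2 + (1 + a * y ^ 2 : ℝ) ∈ Complex.slitPlane := by
  left
  rw [quadratic_re]
  nlinarith [mul_nonneg ha.le (sq_nonneg x)]

lemma integrable_quadratic_cpow (ha : 0 < a) (he : e < -(1 / 2)) {y v : ℝ} (hv : v ^ 2 ≤ y ^ 2) :
    Integrable fun x : ℝ =>
      ((a : ℂ) * ((x : ℂ) + v * Complex.I) ^ 2 + (1 + a * y ^ 2 : ℝ)) ^ (e : ℂ) := by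
  have hb := integrable_one_add_rpow (α := 2) (e := e) ha two_pos (by linarith)
  simp only [Real.rpow_two, sq_abs] at hb
  refine hb.mono' (Continuous.aestronglyMeasurable ?_)
    (Eventually.of_forall fun x => norm_quadratic_cpow_le ha (by linarith) hv)
  refine continuous_iff_continuousAt.2 fun x => ?_
  exact ContinuousAt.cpow (by fun_prop) continuousAt_const (quadratic_mem_slitPlane ha hv)

lemma uIcc_zero_sq_le {v y : ℝ} (hv : v ∈ Set.uIcc 0 y) : v ^ 2 ≤ y ^ 2 := by
  rcases Set.mem_uIcc.1 hv with h | h <;> nlinarith [h.1, h.2]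

/-- Cauchy's theorem on the rectangle over `[-R, R]` between heights `0` and `y`. The vertical sides
are at most `(1 + aR²)^e |y|` and vanish as `R → ∞`. -/
lemma integral_quadratic_cpow_shift (ha : 0 < a) (he : e < -(1 / 2)) (y : ℝ) :
    ∫ x : ℝ, ((a : ℂ) * ((x : ℂ) + y * Complex.I) ^ 2 + (1 + a * y ^ 2 : ℝ)) ^ (e : ℂ) =
      ∫ x : ℝ, ((a : ℂ) * (x : ℂ) ^ 2 + (1 + a * y ^ 2 : ℝ)) ^ (e : ℂ) := by
  set f : ℂ → ℂ := fun z => ((a : ℂ) * z ^ 2 + (1 + a * y ^ 2 : ℝ)) ^ (e : ℂ) with hf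
  have hi1 : Integrable fun x : ℝ => f (x + y * Complex.I) :=
    integrable_quadratic_cpow ha he le_rfl
  have hi0 : Integrable fun x : ℝ => f x := by
    have := integrable_quadratic_cpow (y := y) (v := 0) ha he (by simpa using sq_nonneg y)
    simpa [hf] using this
  have hrect : ∀ R : ℝ, ((∫ x : ℝ in -R..R, f x) - ∫ x : ℝ in -R..R, f (x + y * Complex.I)) +
      Complex.I • (∫ v : ℝ in (0 : ℝ)..y, f (R + v * Complex.I)) -
      Complex.I • (∫ v : ℝ in (0 : ℝ)..y, f ((-R : ℝ) + v * Complex.I)) = 0 := by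
    intro R
    have := Complex.integral_boundary_rect_eq_zero_of_differentiableOn f ((-R : ℝ) : ℂ)
      ((R : ℂ) + y * Complex.I) ?_
    · simpa using this
    · intro z hz
      have hz2 := (Complex.mem_reProdIm.1 hz).2
      simp at hz2
      refine DifferentiableAt.differentiableWithinAt ?_
      refine DifferentiableAt.cpow (by fun_prop) (by fun_prop) ?_
      rw [← Complex.re_add_im z]
      exact quadratic_mem_slitPlane ha (uIcc_zero_sq_le hz2)
  have hvert : ∀ σ : ℝ, σ ^ 2 = 1 → Tendsto (fun R : ℝ =>
      ∫ v : ℝ in (0 : ℝ)..y, f ((σ * R : ℝ) + v * Complex.I)) atTop (𝓝 0) := by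
    intro σ hσ
    have hb : Tendsto (fun R : ℝ => (1 + a * R ^ 2) ^ e * |y - 0|) atTop (𝓝 0) := by
      have h1 : Tendsto (fun R : ℝ => 1 + a * R ^ 2) atTop atTop :=
        tendsto_atTop_add_const_left _ _ ((tendsto_pow_atTop two_ne_zero).const_mul_atTop ha)
      have h2 := (tendsto_rpow_neg_atTop (y := -e) (by linarith)).comp h1
      simpa using h2.mul_const |y - 0|
    refine squeeze_zero_norm (fun R => ?_) hb
    refine intervalIntegral.norm_integral_le_of_norm_le_const fun v hv => ?_
    have := norm_quadratic_cpow_le (x := σ * R) ha (show e < 0 by linarith)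
      (uIcc_zero_sq_le (Set.uIoc_subset_uIcc hv))
    rwa [mul_pow, hσ, one_mul] at this
  have ht0 := intervalIntegral_tendsto_integral hi0 tendsto_neg_atTop_atBot tendsto_id
  have ht1 := intervalIntegral_tendsto_integral hi1 tendsto_neg_atTop_atBot tendsto_id
  have hv1 := hvert 1 (by norm_num)
  have hv2 := hvert (-1) (by norm_num)
  simp only [one_mul, neg_one_mul] at hv1 hv2
  have hlim := ((ht0.sub ht1).add (hv1.const_smul Complex.I)).sub (hv2.const_smul Complex.I)
  simp only [id, hrect, smul_zero, add_zero, sub_zero] at hlim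
  exact (sub_eq_zero.1 (tendsto_nhds_unique hlim tendsto_const_nhds)).symm

/-- Complete the square to `a(x + iy)² + B` with `B = 1 + a y²`, shift to the real axis, and rescale
`x` by `√B`, which yields `B^{e + 1/2}`. -/
lemma integral_one_add_mul_sq_sub_cpow (ha : 0 < a) (he : e < -(1 / 2)) (y : ℝ) :
    ∫ x : ℝ, (1 + a * (x : ℂ) ^ 2 + 2 * a * y * x * Complex.I) ^ (e : ℂ) =
      (((1 + a * y ^ 2) ^ (e + 1 / 2) * ∫ x : ℝ, (1 + a * x ^ 2) ^ e : ℝ) : ℂ) := by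
  have h1 := integral_quadratic_cpow_shift ha he y
  have e1 : ∀ x : ℝ, (a : ℂ) * ((x : ℂ) + y * Complex.I) ^ 2 + (1 + a * y ^ 2 : ℝ) =
      1 + a * (x : ℂ) ^ 2 + 2 * a * y * x * Complex.I := by
    intro x
    push_cast
    ring_nf
    simp
  simp only [e1] at h1
  rw [h1]
  have hB : 0 < 1 + a * y ^ 2 := by positivity
  have e2 : ∀ x : ℝ, ((a : ℂ) * (x : ℂ) ^ 2 + (1 + a * y ^ 2 : ℝ)) ^ (e : ℂ) =
      (((a * x ^ 2 + (1 + a * y ^ 2)) ^ e : ℝ) : ℂ) := by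
    intro x
    rw [Complex.ofReal_cpow (by positivity)]
    push_cast
    rfl
  simp only [e2]
  rw [integral_complex_ofReal]
  congr 1
  set B := 1 + a * y ^ 2
  have hs : 0 < Real.sqrt B := Real.sqrt_pos.2 hB
  have h3 := Measure.integral_comp_mul_left (fun x : ℝ => (a * x ^ 2 + B) ^ e) (Real.sqrt B)
  rw [abs_of_pos (inv_pos.2 hs), smul_eq_mul] at h3
  have h4 : ∀ x : ℝ, (a * (Real.sqrt B * x) ^ 2 + B) ^ e = B ^ e * (1 + a * x ^ 2) ^ e := by
    intro x
    rw [mul_pow, Real.sq_sqrt hB.le, ← Real.mul_rpow hB.le (by positivity)]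
    congr 1
    ring
  simp only [h4] at h3
  rw [integral_const_mul] at h3
  rw [Real.rpow_add hB, ← Real.sqrt_eq_rpow]
  field_simp at h3
  linear_combination -h3

end Contour

/-! ### `q`-Gaussians and their transforms -/

lemma qExp_neg_of_one_lt {s : ℝ} (hs : 1 < s) {x : ℝ} (hx : 0 ≤ x) :
    qExp s (-x) = (1 + (s - 1) * x) ^ (1 / (1 - s)) := by
  rw [qExp, if_neg hs.ne', show 1 + (1 - s) * -x = 1 + (s - 1) * x by ring, max_eq_right]
  nlinarith

/-- One constant `b` normalizes all dilates of the profile; `l` stays free, to tune a tail constant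
or the width of a transform. -/
lemma exists_isDensity_dilations {s α : ℝ} (hs : 1 < s) (hα : 0 < α) (he : α * (1 / (1 - s)) < -1) :
    ∃ b : ℝ, 0 < b ∧ ∀ l : ℝ, 0 < l →
      IsDensity fun x => l * b * qExp s (-(l ^ α * |x| ^ α)) := by
  have e1 : ∀ x : ℝ, qExp s (-(|x| ^ α)) = (1 + (s - 1) * |x| ^ α) ^ (1 / (1 - s)) := fun x =>
    qExp_neg_of_one_lt hs (by positivity)
  have hpos : ∀ x : ℝ, 0 < qExp s (-(|x| ^ α)) := fun x => by
    have : 0 < s - 1 := by linarith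
    rw [e1]; positivity
  have hi : Integrable fun x : ℝ => qExp s (-(|x| ^ α)) := by
    simp only [e1]
    exact integrable_one_add_rpow (by linarith) hα he
  have hI : 0 < ∫ x : ℝ, qExp s (-(|x| ^ α)) := by
    rw [integral_pos_iff_support_of_nonneg (fun x => (hpos x).le) hi]
    rw [show Function.support (fun x : ℝ => qExp s (-(|x| ^ α))) = Set.univ from
      Set.eq_univ_of_forall fun x => (hpos x).ne']
    simp
  have hm : Measurable fun x : ℝ => qExp s (-(|x| ^ α)) := by
    simp only [e1]
    fun_prop
  refine ⟨(∫ x : ℝ, qExp s (-(|x| ^ α)))⁻¹, inv_pos.2 hI, fun l hl => ?_⟩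
  have e2 : ∀ x : ℝ, l ^ α * |x| ^ α = |l * x| ^ α := fun x => by
    rw [abs_mul, abs_of_pos hl, Real.mul_rpow hl.le (abs_nonneg x)]
  simp only [e2]
  refine ⟨measurable_const.mul (hm.comp (measurable_const.mul measurable_id)), fun x => ?_,
    (hi.comp_mul_left' hl.ne').const_mul _, ?_⟩
  · have := hpos (l * x)
    positivity
  · rw [integral_const_mul, Measure.integral_comp_mul_left (fun x => qExp s (-(|x| ^ α))),
      abs_of_pos (inv_pos.2 hl), smul_eq_mul]
    field_simp

/-- The power `s - 1` of the density is `b^{s-1}/(1 + a x²)`, so density and kernel merge into a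
single power `e = 1/(1-s)` of a quadratic, to which the contour shift applies. The condition `s < 3`
means `e < -1/2`, and `e + 1/2 = 1/(1-t)` for `t = (1+s)/(3-s)`. -/
lemma qFourier_qGaussian {s b β : ℝ} (hs : 1 < s) (hs3 : s < 3) (hb : 0 < b) (hβ : 0 < β)
    (hd : IsDensity fun x => b * qExp s (-(β * |x| ^ (2 : ℝ)))) (ξ : ℝ) :
    qFourier s (fun x => b * qExp s (-(β * |x| ^ (2 : ℝ)))) ξ =
      (qExp ((1 + s) / (3 - s))
        (-((3 - s) * b ^ (2 * (s - 1)) / (8 * β) * |ξ| ^ (2 : ℝ))) : ℂ) := by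
  have hs1 : 0 < s - 1 := by linarith
  have h3s : 0 < 3 - s := by linarith
  set e := 1 / (1 - s) with he
  have hes : e * (s - 1) = -1 := by
    have : 1 - s ≠ 0 := by linarith
    rw [he]; field_simp; ring
  have he2 : e < -(1 / 2) := by nlinarith
  set a := (s - 1) * β with ha'
  have ha : 0 < a := by positivity
  have e1 : ∀ x : ℝ, qExp s (-(β * |x| ^ (2 : ℝ))) = (1 + a * x ^ 2) ^ e := fun x => by
    rw [qExp_neg_of_one_lt hs (by positivity), Real.rpow_two, sq_abs, ← mul_assoc]
  simp only [e1] at hd ⊢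
  have hone := hd.integral_eq_one
  rw [integral_const_mul] at hone
  set y := -(ξ * b ^ (s - 1) / (2 * β)) with hy
  have hpt : ∀ x : ℝ, ((b * (1 + a * x ^ 2) ^ e : ℝ) : ℂ) *
      qCExp s (Complex.I * ((x * ξ * (b * (1 + a * x ^ 2) ^ e) ^ (s - 1) : ℝ) : ℂ)) =
      b * (1 + a * (x : ℂ) ^ 2 + 2 * a * y * x * Complex.I) ^ (e : ℂ) := by
    intro x
    have hw : 0 < 1 + a * x ^ 2 := by positivity
    have hp : (b * (1 + a * x ^ 2) ^ e) ^ (s - 1) = b ^ (s - 1) * (1 + a * x ^ 2)⁻¹ := by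
      rw [Real.mul_rpow hb.le (by positivity), ← Real.rpow_mul hw.le, hes, Real.rpow_neg_one]
    have hc : (1 / (1 - (s : ℂ))) = (e : ℂ) := by rw [he]; push_cast; rfl
    rw [qCExp_of_ne hs.ne', hc, hp, Complex.ofReal_mul, Complex.ofReal_cpow hw.le, mul_assoc,
      ← ofReal_mul_cpow hw]
    · congr 2
      have hw' : (1 + (a : ℂ) * (x : ℂ) ^ 2) ≠ 0 := by exact_mod_cast hw.ne'
      have hβ' : (β : ℂ) ≠ 0 := by exact_mod_cast hβ.ne'
      rw [hy, ha']
      rw [ha'] at hw'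
      push_cast at hw' ⊢
      field_simp
      ring
    · exact Complex.slitPlane_ne_zero (one_sub_mul_I_mul_mem_slitPlane s _)
  unfold qFourier
  simp only [hpt]
  rw [integral_const_mul, integral_one_add_mul_sq_sub_cpow ha he2, ← Complex.ofReal_mul]
  congr 1
  have ht : 1 < (1 + s) / (3 - s) := by rw [lt_div_iff₀ h3s]; linarith
  rw [qExp_neg_of_one_lt ht (by positivity)]
  have hexp : 1 / (1 - (1 + s) / (3 - s)) = e + 1 / 2 := by
    have : 1 - s ≠ 0 := by linarith
    rw [he, show 1 - (1 + s) / (3 - s) = 2 * (1 - s) / (3 - s) by field_simp; ring]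
    field_simp
    ring
  have hbase : 1 + ((1 + s) / (3 - s) - 1) *
      ((3 - s) * b ^ (2 * (s - 1)) / (8 * β) * |ξ| ^ (2 : ℝ)) = 1 + a * y ^ 2 := by
    rw [hy, ha', Real.rpow_two, sq_abs, two_mul, Real.rpow_add hb]
    field_simp
    ring
  rw [hexp, hbase]
  linear_combination ((1 + a * y ^ 2) ^ (e + 1 / 2)) * hone

/-- Dilating by `l` multiplies the width of the transform by `l^{2(s-2)}`, so every `β₀` is attained
unless `s = 2`, where the transform is invariant under dilation. -/
lemma exists_qGaussian {s : ℝ} (hs : 1 < s) (hs3 : s < 3) {β₀ : ℝ} (hβ₀ : 0 < β₀) :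
    ∃ h ∈ G s 2, IsDensity h ∧ ∃ β : ℝ, 0 < β ∧ (s ≠ 2 → β = β₀) ∧ ∀ ξ : ℝ,
      qFourier s h ξ = (qExp ((1 + s) / (3 - s)) (-(β * |ξ| ^ (2 : ℝ))) : ℂ) := by
  have hs1 : 0 < s - 1 := by linarith
  have h3s : 0 < 3 - s := by linarith
  obtain ⟨b, hb, hd⟩ := exists_isDensity_dilations (α := 2) hs two_pos (by
    rw [← neg_sub, div_neg, mul_neg, neg_lt_neg_iff, mul_one_div, lt_div_iff₀ hs1]
    linarith)
  set c := (3 - s) * b ^ (2 * (s - 1)) / 8 with hc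
  have hc0 : 0 < c := by positivity
  obtain ⟨l, hl, hls⟩ : ∃ l : ℝ, 0 < l ∧ (s ≠ 2 → c * l ^ (2 * (s - 2)) = β₀) := by
    refine ⟨(β₀ / c) ^ (1 / (2 * (s - 2))), by positivity, fun h2 => ?_⟩
    have : 2 * (s - 2) ≠ 0 := mul_ne_zero two_ne_zero (sub_ne_zero.2 h2)
    rw [← Real.rpow_mul (by positivity), one_div_mul_cancel this, Real.rpow_one]
    field_simp
  refine ⟨_, ⟨l * b, l ^ (2 : ℝ), by positivity, by positivity, fun x => rfl⟩, hd l hl,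
    c * l ^ (2 * (s - 2)), by positivity, hls, fun ξ => ?_⟩
  rw [qFourier_qGaussian hs hs3 (by positivity) (by positivity) (hd l hl)]
  congr 4
  rw [hc, Real.mul_rpow hl.le hb.le, show 2 * (s - 2) = 2 * (s - 1) - 2 by ring, Real.rpow_sub hl]
  field_simp

lemma isEquivalent_qExp {s β α : ℝ} (hs : 1 < s) (hβ : 0 < β) (hα : 0 < α) (b : ℝ) :
    (fun x : ℝ => b * qExp s (-(β * |x| ^ α))) ~[cocompact ℝ]
      fun x => b * ((s - 1) * β) ^ (1 / (1 - s)) * |x| ^ (α * (1 / (1 - s))) := by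
  have h := (IsEquivalent.refl (u := fun _ : ℝ => b) (l := cocompact ℝ)).mul
    (isEquivalent_one_add_rpow (a := (s - 1) * β) (e := 1 / (1 - s))
      (mul_pos (by linarith) hβ) hα)
  convert h using 1
  · ext x
    simp only [Pi.mul_apply]
    rw [qExp_neg_of_one_lt hs (by positivity), mul_assoc (s - 1)]
  · ext x
    simp only [Pi.mul_apply]
    ring

/-! ### Densities from limits of characteristic functions -/

section FourierInversion

open FourierTransform

/-- The Gaussian regularization of the inverse transform of a probability measure is positive. -/
lemma integral_charFun_mul_gaussian (μ : Measure ℝ) [IsProbabilityMeasure μ] {a : ℝ} (ha : 0 < a)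
    (x : ℝ) :
    ∃ r : ℝ, 0 ≤ r ∧ ∫ v : ℝ, charFun μ v *
      Complex.exp (-(a : ℂ) * v ^ 2 + (-(x * Complex.I)) * v) = r := by
  have ha' : 0 < (a : ℂ).re := by simpa
  have hgi := integrable_cexp_quadratic ha' (-(x * Complex.I)) 0
  simp only [add_zero] at hgi
  have hint : Integrable (Function.uncurry fun (v u : ℝ) => Complex.exp (v * u * Complex.I) *
      Complex.exp (-(a : ℂ) * v ^ 2 + (-(x * Complex.I)) * v)) (volume.prod μ) := by
    have h1 : Integrable (fun z : ℝ × ℝ => Complex.exp (-(a : ℂ) * z.1 ^ 2 +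
        (-(x * Complex.I)) * z.1)) (volume.prod μ) := hgi.comp_fst μ
    refine h1.bdd_mul (c := 1) (by fun_prop) (Eventually.of_forall fun z => ?_)
    rw [← Complex.ofReal_mul, Complex.norm_exp_ofReal_mul_I]
  -- By Fubini and the Gaussian transform, the integral is a `μ`-average of Gaussians centred at
  -- `x`.
  refine ⟨∫ u, Real.sqrt (Real.pi / a) * Real.exp (-(u - x) ^ 2 / (4 * a)) ∂μ,
    integral_nonneg fun u => by positivity, ?_⟩
  simp only [charFun_apply_real, ← integral_mul_const]
  rw [integral_integral_swap hint, ← integral_complex_ofReal]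
  congr 1
  ext u
  have := fourierIntegral_gaussian ha' ((u - x : ℝ) : ℂ)
  have hsq : (Real.pi / a : ℂ) ^ (1 / 2 : ℂ) = ((Real.sqrt (Real.pi / a) : ℝ) : ℂ) := by
    rw [Real.sqrt_eq_rpow, Complex.ofReal_cpow (by positivity)]
    push_cast
    rfl
  rw [hsq] at this
  push_cast at this ⊢
  rw [← this]
  congr 1
  ext v
  rw [← Complex.exp_add, ← Complex.exp_add]
  congr 1
  ring

section Limit

variable {μ : ℕ → Measure ℝ} [∀ n, IsProbabilityMeasure (μ n)] {φ : ℝ → ℂ}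

lemma norm_le_one_of_tendsto_charFun
    (h : ∀ t, Tendsto (fun n => charFun (μ n) t) atTop (𝓝 (φ t))) (t : ℝ) : ‖φ t‖ ≤ 1 :=
  le_of_tendsto (h t).norm (Eventually.of_forall fun _ => norm_charFun_le_one t)

/-- Nonnegativity survives two dominated limits: first `n → ∞` at a fixed regularization `a`, with a
Gaussian majorant, then `a → 0`, with majorant `‖φ‖`. -/
lemma exists_fourier_eq_of_tendsto_charFun (hc : Continuous φ) (hi : Integrable φ)
    (h : ∀ t, Tendsto (fun n => charFun (μ n) t) atTop (𝓝 (φ t))) (w : ℝ) :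
    ∃ r : ℝ, 0 ≤ r ∧ 𝓕 φ w = r := by
  have hclosed : IsClosed {z : ℂ | 0 ≤ z.re ∧ z.im = 0} :=
    (isClosed_le continuous_const Complex.continuous_re).inter
      (isClosed_eq Complex.continuous_im continuous_const)
  have hmem : ∀ z : ℂ, (∃ r : ℝ, 0 ≤ r ∧ z = r) → z ∈ {z : ℂ | 0 ≤ z.re ∧ z.im = 0} := by
    rintro z ⟨r, hr, rfl⟩
    simpa using hr
  set x := 2 * Real.pi * w with hx
  have hreg : ∀ a : ℝ, 0 < a → (∫ v : ℝ, φ v *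
      Complex.exp (-(a : ℂ) * v ^ 2 + (-(x * Complex.I)) * v)) ∈
        {z : ℂ | 0 ≤ z.re ∧ z.im = 0} := by
    intro a ha
    have ha' : 0 < (a : ℂ).re := by simpa
    have hgi := integrable_cexp_quadratic ha' (-(x * Complex.I)) 0
    simp only [add_zero] at hgi
    have hlim : Tendsto (fun n => ∫ v : ℝ, charFun (μ n) v *
        Complex.exp (-(a : ℂ) * v ^ 2 + (-(x * Complex.I)) * v)) atTop
        (𝓝 (∫ v : ℝ, φ v * Complex.exp (-(a : ℂ) * v ^ 2 + (-(x * Complex.I)) * v))) := by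
      refine tendsto_integral_of_dominated_convergence _ (fun n => ?_) hgi.norm
        (fun n => Eventually.of_forall fun v => ?_) (Eventually.of_forall fun v => ?_)
      · exact measurable_charFun.aestronglyMeasurable.mul hgi.aestronglyMeasurable
      · rw [norm_mul]
        exact mul_le_of_le_one_left (norm_nonneg _) (norm_charFun_le_one v)
      · exact (h v).mul_const _
    exact hclosed.mem_of_tendsto hlim
      (Eventually.of_forall fun n => hmem _ (integral_charFun_mul_gaussian (μ n) ha x))
  have hlim : Tendsto (fun n : ℕ => ∫ v : ℝ, φ v *
      Complex.exp (-((1 / ((n : ℝ) + 1) : ℝ) : ℂ) * v ^ 2 + (-(x * Complex.I)) * v)) atTop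
      (𝓝 (𝓕 φ w)) := by
    rw [Real.fourier_real_eq_integral_exp_smul]
    refine tendsto_integral_of_dominated_convergence (fun v => ‖φ v‖) (fun n => ?_) hi.norm
      (fun n => Eventually.of_forall fun v => ?_) (Eventually.of_forall fun v => ?_)
    · exact (by fun_prop : Continuous fun v : ℝ => φ v *
        Complex.exp (-((1 / ((n : ℝ) + 1) : ℝ) : ℂ) * v ^ 2 +
          (-(x * Complex.I)) * v)).aestronglyMeasurable
    · rw [norm_mul, Complex.norm_exp]
      refine mul_le_of_le_one_right (norm_nonneg _) (Real.exp_le_one_iff.2 ?_)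
      have e : (-((1 / ((n : ℝ) + 1) : ℝ) : ℂ) * (v : ℂ) ^ 2 + (-(x * Complex.I)) * v).re =
          -(1 / ((n : ℝ) + 1)) * v ^ 2 := by
        rw [← Complex.ofReal_pow, ← Complex.ofReal_neg, Complex.add_re, Complex.re_ofReal_mul,
          Complex.ofReal_re]
        simp
      rw [e]
      have : 0 ≤ 1 / ((n : ℝ) + 1) * v ^ 2 := by positivity
      linarith
    · have h1 : Tendsto (fun n : ℕ => ((1 / ((n : ℝ) + 1) : ℝ) : ℂ)) atTop (𝓝 ((0 : ℝ) : ℂ)) :=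
        (Complex.continuous_ofReal.tendsto 0).comp tendsto_one_div_add_atTop_nhds_zero_nat
      have h2 := ((Complex.continuous_exp.tendsto _).comp
        ((h1.neg.mul_const ((v : ℂ) ^ 2)).add_const (-(x * Complex.I) * v))).const_mul (φ v)
      have e : Complex.exp ((-2 * Real.pi * v * w : ℝ) * Complex.I) • φ v =
          φ v * Complex.exp (-((0 : ℝ) : ℂ) * (v : ℂ) ^ 2 + -(x * Complex.I) * v) := by
        rw [smul_eq_mul, mul_comm, hx]
        congr 2
        push_cast
        ring
      rw [e]
      exact h2
  have := hclosed.mem_of_tendsto hlim (Eventually.of_forall fun n => hreg _ (by positivity))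
  exact ⟨(𝓕 φ w).re, this.1, Complex.ext (by simp) (by simpa using this.2)⟩

/-- Move the transform onto the Gaussian: its image has total mass `1`, and `‖φ‖ ≤ 1`. -/
lemma integral_fourier_mul_gaussian (hi : Integrable φ) (hφ : ∀ t, ‖φ t‖ ≤ 1)
    {b : ℝ} (hb : 0 < b) :
    ‖∫ w : ℝ, 𝓕 φ w * Complex.exp (-Real.pi * b * w ^ 2)‖ ≤ 1 := by
  have hb' : 0 < (b : ℂ).re := by simpa
  have hψ : Integrable fun w : ℝ => Complex.exp (-Real.pi * b * w ^ 2) := by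
    have := integrable_cexp_quadratic (b := (Real.pi * b : ℝ))
      (by rw [Complex.ofReal_re]; positivity) 0 0
    simpa using this
  have hflip : ∫ w : ℝ, 𝓕 φ w * Complex.exp (-Real.pi * b * w ^ 2) =
      ∫ v : ℝ, φ v * 𝓕 (fun w : ℝ => Complex.exp (-Real.pi * b * w ^ 2)) v := by
    simpa using! (VectorFourier.integral_fourierIntegral_smul_eq_flip (L := innerₗ ℝ)
      Real.continuous_fourierChar continuous_inner hi hψ)
  rw [hflip, fourier_gaussian_pi hb']
  have hbnd : ∀ v : ℝ, ‖φ v * (1 / (b : ℂ) ^ (1 / 2 : ℂ) *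
      Complex.exp (-Real.pi / b * v ^ 2))‖ ≤
      1 / Real.sqrt b * Real.exp (-(Real.pi / b) * v ^ 2) := by
    intro v
    have e1 : (b : ℂ) ^ (1 / 2 : ℂ) = ((Real.sqrt b : ℝ) : ℂ) := by
      rw [Real.sqrt_eq_rpow, Complex.ofReal_cpow hb.le]
      push_cast
      rfl
    have e2 : Complex.exp (-Real.pi / b * v ^ 2) = (Real.exp (-(Real.pi / b) * v ^ 2) : ℂ) := by
      push_cast
      ring_nf
    rw [e1, e2, ← Complex.ofReal_one, ← Complex.ofReal_div, ← Complex.ofReal_mul, norm_mul,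
      Complex.norm_real, Real.norm_of_nonneg (by positivity)]
    exact mul_le_of_le_one_left (by positivity) (hφ v)
  refine (norm_integral_le_of_norm_le ((integrable_exp_neg_mul_sq (b := Real.pi / b)
    (by positivity)).const_mul _) (Eventually.of_forall hbnd)).trans_eq ?_
  rw [integral_const_mul, integral_gaussian, div_div_cancel₀ Real.pi_pos.ne']
  have := Real.sqrt_pos.2 hb
  field_simp

lemma continuous_fourier_of_integrable (hi : Integrable φ) : Continuous (𝓕 φ) :=
  VectorFourier.fourierIntegral_continuous Real.continuous_fourierChar
    (by exact continuous_inner) hi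

/-- On `[-(n+1), n+1]` the Gaussian with `b = 1/(n+1)²` is at least `e^{-π}`, so its bound `1` gives
`∫ γ ≤ e^π` there, uniformly in `n`; nonnegativity turns this into integrability. -/
lemma integrable_fourier_of_nonneg (hi : Integrable φ) (hφ : ∀ t, ‖φ t‖ ≤ 1) {γ : ℝ → ℝ}
    (hγ : ∀ w, 0 ≤ γ w) (he : ∀ w, 𝓕 φ w = γ w) : Integrable γ := by
  have hγc : Continuous γ := by
    have := Complex.continuous_re.comp (continuous_fourier_of_integrable hi)
    simpa [Function.comp_def, he] using this
  have hγb : ∀ w, γ w ≤ ∫ v, ‖φ v‖ := by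
    intro w
    have := VectorFourier.norm_fourierIntegral_le_integral_norm Real.fourierChar volume
      (innerₗ ℝ) φ w
    have h2 : ‖𝓕 φ w‖ ≤ ∫ v, ‖φ v‖ := this
    rwa [he, Complex.norm_real, Real.norm_of_nonneg (hγ w)] at h2
  refine integrable_of_intervalIntegral_norm_bounded (l := atTop) (ι := ℕ)
    (a := fun n => -((n : ℝ) + 1)) (b := fun n => (n : ℝ) + 1) (Real.exp Real.pi)
    (fun n => (hγc.integrableOn_Icc).mono_set Set.Ioc_subset_Icc_self)
    (tendsto_neg_atTop_atBot.comp
      (tendsto_atTop_add_const_right _ _ tendsto_natCast_atTop_atTop))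
    (tendsto_atTop_add_const_right _ _ tendsto_natCast_atTop_atTop)
    (Eventually.of_forall fun n => ?_)
  have hn : (0 : ℝ) < n + 1 := by positivity
  set b : ℝ := 1 / ((n : ℝ) + 1) ^ 2 with hbdef
  have hb : 0 < b := by positivity
  have hge : Integrable fun w : ℝ => γ w * Real.exp (-(Real.pi * b) * w ^ 2) := by
    refine (integrable_exp_neg_mul_sq (b := Real.pi * b) (by positivity)).bdd_mul
      (c := ∫ v, ‖φ v‖) hγc.aestronglyMeasurable (Eventually.of_forall fun w => ?_)
    rw [Real.norm_of_nonneg (hγ w)]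
    exact hγb w
  have hle1 : ∫ w, γ w * Real.exp (-(Real.pi * b) * w ^ 2) ≤ 1 := by
    have := integral_fourier_mul_gaussian hi hφ hb
    have e : ∀ w : ℝ, 𝓕 φ w * Complex.exp (-Real.pi * b * w ^ 2) =
        ((γ w * Real.exp (-(Real.pi * b) * w ^ 2) : ℝ) : ℂ) := fun w => by
      rw [he]; push_cast; ring_nf
    simp only [e] at this
    rw [integral_complex_ofReal, Complex.norm_real] at this
    exact (le_abs_self _).trans this
  rw [intervalIntegral.integral_of_le (by linarith)]
  calc ∫ w in Set.Ioc (-((n : ℝ) + 1)) (n + 1), ‖γ w‖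
      ≤ ∫ w in Set.Ioc (-((n : ℝ) + 1)) (n + 1),
          Real.exp Real.pi * (γ w * Real.exp (-(Real.pi * b) * w ^ 2)) := by
        refine setIntegral_mono_on
          ((hγc.norm.integrableOn_Icc).mono_set Set.Ioc_subset_Icc_self)
          (hge.const_mul _).integrableOn measurableSet_Ioc fun w hw => ?_
        rw [Real.norm_of_nonneg (hγ w), mul_left_comm, ← Real.exp_add]
        refine le_mul_of_one_le_right (hγ w) (Real.one_le_exp ?_)
        have hw2 : w ^ 2 ≤ ((n : ℝ) + 1) ^ 2 := sq_le_sq' hw.1.le hw.2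
        have : b * w ^ 2 ≤ 1 := by
          rw [hbdef, one_div, inv_mul_le_iff₀ (by positivity), mul_one]
          exact hw2
        nlinarith [Real.pi_pos]
    _ ≤ ∫ w, Real.exp Real.pi * (γ w * Real.exp (-(Real.pi * b) * w ^ 2)) :=
        setIntegral_le_integral (hge.const_mul _)
          (Eventually.of_forall fun w => by have := hγ w; simp only [Pi.zero_apply]; positivity)
    _ ≤ Real.exp Real.pi := by
        rw [integral_const_mul]
        exact mul_le_of_le_one_right (Real.exp_pos _).le hle1

/-- An integrable limit of characteristic functions is the transform of a density. -/
lemma exists_isDensity_of_tendsto_charFun (hc : Continuous φ) (hi : Integrable φ) (h0 : φ 0 = 1)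
    (h : ∀ t, Tendsto (fun n => charFun (μ n) t) atTop (𝓝 (φ t))) :
    ∃ g : ℝ → ℝ, IsDensity g ∧ ∀ ξ : ℝ, qFourier 1 g ξ = φ ξ := by
  choose γ hγ he using exists_fourier_eq_of_tendsto_charFun hc hi h
  have hγi := integrable_fourier_of_nonneg hi (norm_le_one_of_tendsto_charFun h) hγ he
  have hγm : Measurable γ := by
    have := (Complex.continuous_re.comp (continuous_fourier_of_integrable hi)).measurable
    simpa [Function.comp_def, he] using this
  have hinv : ∀ ξ : ℝ, ∫ w : ℝ, (γ w : ℂ) * Complex.exp (2 * Real.pi * w * ξ * Complex.I) =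
      φ ξ := by
    intro ξ
    have hFi : Integrable (𝓕 φ) := by
      rw [funext he]
      exact hγi.ofReal
    have := congrFun (hc.fourierInv_fourier_eq hi hFi) ξ
    rw [Real.fourierInv_eq'] at this
    rw [← this]
    congr 1
    ext w
    rw [he, smul_eq_mul, mul_comm]
    congr 2
    simp
    ring
  -- The dilation by `2π` passes from the kernel `e^{2πiwξ}` to `e^{ixξ}`.
  have hF : ∀ ξ : ℝ, qFourier 1 (fun x => (2 * Real.pi)⁻¹ * γ ((2 * Real.pi)⁻¹ * x)) ξ = φ ξ := by
    intro ξ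
    rw [qFourier_mul_comp_mul 1 hγ (by positivity), ← hinv, qFourier]
    congr 1
    ext w
    rw [qCExp, if_pos rfl, Real.inv_rpow (by positivity), show (1 : ℝ) - 2 = -1 by norm_num,
      Real.rpow_neg_one, inv_inv, sub_self, Real.rpow_zero]
    congr 2
    push_cast
    ring
  refine ⟨fun x => (2 * Real.pi)⁻¹ * γ ((2 * Real.pi)⁻¹ * x), ⟨measurable_const.mul (hγm.comp (measurable_const.mul measurable_id)), fun x => ?_,
    (hγi.comp_mul_left' (by positivity)).const_mul _, ?_⟩, hF⟩
  · have := hγ ((2 * Real.pi)⁻¹ * x)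
    have := Real.pi_pos
    positivity
  · have := hinv 0
    simp only [Complex.ofReal_zero, mul_zero, zero_mul, Complex.exp_zero, mul_one, h0] at this
    rw [integral_complex_ofReal] at this
    have h1 : ∫ w, γ w = 1 := by exact_mod_cast this
    rw [integral_const_mul, Measure.integral_comp_mul_left, h1]
    have := Real.pi_pos
    rw [abs_of_pos (by positivity)]
    simp
    field_simp

end Limit

lemma charFun_map_eq_qFourierRV {Ω : Type*} [MeasurableSpace Ω] {P : Measure Ω}
    [IsProbabilityMeasure P] {Z : Ω → ℝ} (hZ : HasPDF Z P volume) (ξ : ℝ) :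
    charFun (P.map Z) ξ = qFourierRV 1 P Z ξ := by
  have hm : AEMeasurable Z P := HasPDF.aemeasurable Z P volume
  have hc : Continuous fun x : ℝ => Complex.exp (ξ * x * Complex.I) := by fun_prop
  rw [charFun_apply_real, integral_map hm hc.aestronglyMeasurable, qFourierRV, qFourier,
    ← pdf.integral_pdf_smul (μ := volume) hc.aestronglyMeasurable]
  congr 1
  ext x
  rw [Complex.real_smul]
  simp [qCExp]
  left
  ring_nf

lemma integrable_exp_neg_abs_rpow {α : ℝ} (h0 : 0 < α) :
    Integrable fun x : ℝ => Real.exp (-(|x| ^ α)) := by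
  have := integrableOn_rpow_mul_exp_neg_rpow (p := α) (s := 0) (by norm_num) h0
  simp only [Real.rpow_zero, one_mul] at this
  exact integrable_comp_abs_of_integrableOn this

end FourierInversion

/-! ### Index arithmetic and preimages of the limit -/

lemma one_le_qSeq {α q : ℝ} (h0 : 0 < α) (hq : 1 ≤ q) {k : ℤ} (hk : (k : ℝ) * (q - 1) < α) :
    1 ≤ qSeq α q k := by
  have h1 : 0 < α - k * (q - 1) := by linarith
  have : 0 ≤ α * (q - 1) / (α - k * (q - 1)) :=
    div_nonneg (mul_nonneg h0.le (by linarith)) h1.le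
  rw [qSeq]
  linarith

lemma qSeq_one (α : ℝ) (k : ℤ) : qSeq α 1 k = 1 := by simp [qSeq]

lemma qStar_one (α : ℝ) (k : ℤ) : qStar α 1 k = 1 := by simp [qStar, zeta, qSeq_one]

/-- For `q > 1`, `1/(q_{α,n} - 1) = 1/(q-1) - n/α` is an arithmetic progression, so the step from
`k` to `k - 1` adds `1/α`. -/
lemma qSeq_pred_sub_one {α q : ℝ} (h0 : 0 < α) (hq : 1 ≤ q) {k : ℤ}
    (hk : (k : ℝ) * (q - 1) < α) :
    qSeq α q (k - 1) - 1 = α * (qSeq α q k - 1) / (α + (qSeq α q k - 1)) := by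
  have h1 : 0 < α - k * (q - 1) := by linarith
  rw [qSeq, qSeq, add_sub_cancel_left, add_sub_cancel_left]
  push_cast
  rw [show α - ((k : ℝ) - 1) * (q - 1) = α - k * (q - 1) + (q - 1) by ring]
  have h2 : 0 ≤ q - 1 := by linarith
  generalize α - k * (q - 1) = D at h1 ⊢
  generalize q - 1 = d at h2 ⊢
  have h3 : 0 < D + d := by linarith
  have h4 : α + α * d / D = α * (D + d) / D := by field_simp
  rw [h4]
  field_simp

lemma isEquivalent_of_tail {g h : ℝ → ℝ} {a b c d : ℝ}
    (hg : g ~[cocompact ℝ] fun x => a * |x| ^ c) (hh : h ~[cocompact ℝ] fun x => b * |x| ^ d)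
    (hab : a = b) (hcd : c = d) : g ~[cocompact ℝ] h := by
  subst hab hcd
  exact hg.trans hh.symm

/-- A density of `𝒢_s[α]` with a prescribed tail constant. -/
lemma exists_mem_G_isEquivalent {s α : ℝ} (hs : 1 < s) (h0 : 0 < α) (hsα : s - 1 < α) {T : ℝ}
    (hT : 0 < T) :
    ∃ g ∈ G s α, IsDensity g ∧
      g ~[cocompact ℝ] fun x => T * |x| ^ (α * (1 / (1 - s))) := by
  have hs1 : 0 < s - 1 := by linarith
  have he : α * (1 / (1 - s)) < -1 := by
    rw [← neg_sub, div_neg, mul_neg, neg_lt_neg_iff, mul_one_div, lt_div_iff₀ hs1]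
    linarith
  obtain ⟨b, hb, hd⟩ := exists_isDensity_dilations hs h0 he
  set e := 1 / (1 - s)
  have hc : 0 < b * (s - 1) ^ e := by positivity
  -- Dilating by `l` multiplies the tail constant by `l^{1+αe}`, whose exponent is nonzero because
  -- `αe < -1`.
  set l := (T / (b * (s - 1) ^ e)) ^ (1 / (1 + α * e)) with hl
  have hl0 : 0 < l := by positivity
  have hle : l ^ (1 + α * e) * (b * (s - 1) ^ e) = T := by
    have : 1 + α * e ≠ 0 := by linarith
    rw [hl, ← Real.rpow_mul (by positivity), one_div_mul_cancel this, Real.rpow_one]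
    field_simp
  refine ⟨_, ⟨l * b, l ^ α, by positivity, by positivity, fun x => rfl⟩, hd l hl0, ?_⟩
  have := isEquivalent_qExp (b := l * b) (β := l ^ α) hs (by positivity) h0
  rw [Real.mul_rpow hs1.le (by positivity), ← Real.rpow_mul hl0.le,
    show l * b * ((s - 1) ^ (1 / (1 - s)) * l ^ (α * (1 / (1 - s)))) = T by
      rw [← hle, Real.rpow_add hl0, Real.rpow_one]; ring] at this
  exact this

/-- The indices are such that `α/(1-s) = 2/(1-z)` and `2/(1-t) = α/(1-Q)`, where `z = ζ_α(s)`, so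
both pairs of tails agree up to constants. The constant of `g` is fitted to that of `h`, and `c` is
the remaining ratio on the Fourier side. -/
lemma exists_isAsympImage {α Q s : ℝ} (h0 : 0 < α) (hQ : 1 < Q)
    (hs : s - 1 = α * (Q - 1) / (α + (Q - 1))) :
    ∃ (c : ℝ) (g : ℝ → ℝ), 0 < c ∧ (zeta α s ≠ 2 → c = 1) ∧
      IsAsympImage s α c g (fun ξ => qExp Q (-(|ξ| ^ α))) := by
  have hQ1 : 0 < Q - 1 := by linarith
  have hs1 : 0 < s - 1 := by rw [hs]; positivity
  have hs1' : 1 < s := by linarith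
  have hsα : s - 1 < α := by
    rw [hs, div_lt_iff₀ (by positivity)]
    nlinarith
  set z := zeta α s with hz
  have hz1 : z - 1 = 2 * (Q - 1) / (α + (Q - 1)) := by
    rw [hz, zeta, hs]; field_simp; ring
  have hz1' : 1 < z := by
    have : 0 < z - 1 := by rw [hz1]; positivity
    linarith
  have hz3 : 3 - z = 2 * α / (α + (Q - 1)) := by
    rw [show 3 - z = 2 - (z - 1) by ring, hz1]; field_simp; ring
  have hz3' : z < 3 := by
    have : 0 < 3 - z := by rw [hz3]; positivity
    linarith
  have ht : (1 + z) / (3 - z) - 1 = 2 * (Q - 1) / α := by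
    rw [hz3, show 1 + z = 2 + (z - 1) by ring, hz1]; field_simp; ring
  set t := (1 + z) / (3 - z) with htdef
  have ht0 : 0 < t - 1 := by rw [ht]; positivity
  have ht1 : 1 < t := by linarith
  have h1Q : 1 - Q ≠ 0 := by linarith
  have h1t : 1 - t ≠ 0 := by linarith
  have h1z : 1 - z ≠ 0 := by linarith
  have h1s : 1 - s ≠ 0 := by linarith
  -- The solution of `((t-1)β)^{1/(1-t)} = (Q-1)^{1/(1-Q)}`, that is, of `c = 1`.
  set β₀ := (Q - 1) ^ ((1 - t) / (1 - Q)) / (t - 1) with hβ₀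
  have hβ₀0 : 0 < β₀ := by positivity
  obtain ⟨h, hhG, hhd, β, hβ, hβe, hF⟩ := exists_qGaussian hz1' hz3' hβ₀0
  obtain ⟨b', β', hb', hβ', hh⟩ := id hhG
  have hhtail : h ~[cocompact ℝ] fun x =>
      b' * ((z - 1) * β') ^ (1 / (1 - z)) * |x| ^ ((2 : ℝ) * (1 / (1 - z))) := by
    rw [show h = fun x => b' * qExp z (-(β' * |x| ^ (2 : ℝ))) from funext hh]
    exact isEquivalent_qExp hz1' hβ' two_pos b'
  obtain ⟨g, hgG, hgd, hgtail⟩ := exists_mem_G_isEquivalent hs1' h0 hsα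
    (T := b' * ((z - 1) * β') ^ (1 / (1 - z)))
    (mul_pos hb' (Real.rpow_pos_of_pos (mul_pos (by linarith) hβ') _))
  have hexp1 : α * (1 / (1 - s)) = 2 * (1 / (1 - z)) := by
    rw [show 1 - s = -(s - 1) by ring, show 1 - z = -(z - 1) by ring, hs, hz1]
    field_simp
  have hexp2 : 2 * (1 / (1 - t)) = α * (1 / (1 - Q)) := by
    rw [show 1 - t = -(t - 1) by ring, show 1 - Q = -(Q - 1) by ring, ht]
    field_simp
  have hφ1 := isEquivalent_qExp (β := β) ht1 hβ two_pos 1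
  simp only [one_mul] at hφ1
  set c := ((t - 1) * β) ^ (1 / (1 - t)) / (Q - 1) ^ (1 / (1 - Q)) with hc
  have hφ2 := isEquivalent_qExp (β := 1) hQ one_pos h0 c
  simp only [one_mul, mul_one] at hφ2
  have hQe : 0 < (Q - 1) ^ (1 / (1 - Q)) := Real.rpow_pos_of_pos hQ1 _
  refine ⟨c, g, by positivity, fun hne => ?_, hgG, hgd, h, hhG, hhd,
    isEquivalent_of_tail hgtail hhtail rfl hexp1, β, hβ, hF,
    isEquivalent_of_tail hφ1 hφ2 (by rw [hc]; field_simp) hexp2⟩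
  rw [hc, hβe hne, hβ₀, mul_div_cancel₀ _ ht0.ne', ← Real.rpow_mul hQ1.le,
    show (1 - t) / (1 - Q) * (1 / (1 - t)) = 1 / (1 - Q) by field_simp, div_self hQe.ne']

lemma exists_gaussian_preimage :
    ∃ g ∈ G 1 2, IsDensity g ∧
      ∀ ξ : ℝ, qFourier 1 g ξ = (qExp 1 (-(|ξ| ^ (2 : ℝ))) : ℂ) := by
  have hsqrt : 0 < Real.sqrt (Real.pi / (1 / 4)) := Real.sqrt_pos.2 (by positivity)
  refine ⟨fun x => (Real.sqrt (Real.pi / (1 / 4)))⁻¹ * qExp 1 (-(1 / 4 * |x| ^ (2 : ℝ))),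
    ⟨_, 1 / 4, inv_pos.2 hsqrt, by norm_num, fun x => rfl⟩, ?_, fun ξ => ?_⟩
  · have e : ∀ x : ℝ, qExp 1 (-(1 / 4 * |x| ^ (2 : ℝ))) = Real.exp (-(1 / 4) * x ^ 2) := fun x => by
      rw [qExp, if_pos rfl, Real.rpow_two, sq_abs, neg_mul]
    simp only [e]
    refine ⟨by fun_prop, fun x => by positivity,
      (integrable_exp_neg_mul_sq (by norm_num)).const_mul _, ?_⟩
    rw [integral_const_mul, integral_gaussian, inv_mul_cancel₀ hsqrt.ne']
  · have hf := fourierIntegral_gaussian (b := (1 / 4 : ℂ)) (by norm_num) ξ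
    have hsq : (Real.pi / (1 / 4) : ℂ) ^ (1 / 2 : ℂ) =
        ((Real.sqrt (Real.pi / (1 / 4)) : ℝ) : ℂ) := by
      rw [Real.sqrt_eq_rpow, Complex.ofReal_cpow (by positivity)]
      push_cast
      rfl
    have hne : ((Real.sqrt (Real.pi / (1 / 4)) : ℝ) : ℂ) ≠ 0 := by exact_mod_cast hsqrt.ne'
    rw [hsq] at hf
    have key : qFourier 1 (fun x => (Real.sqrt (Real.pi / (1 / 4)))⁻¹ *
        qExp 1 (-(1 / 4 * |x| ^ (2 : ℝ)))) ξ =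
        ((Real.sqrt (Real.pi / (1 / 4)) : ℝ) : ℂ)⁻¹ *
          ∫ x : ℝ, Complex.exp (Complex.I * ξ * x) * Complex.exp (-(1 / 4) * (x : ℂ) ^ 2) := by
      rw [qFourier, ← integral_const_mul]
      congr 1
      ext x
      simp only [qExp, qCExp, if_true, sub_self, Real.rpow_zero, Real.rpow_two, sq_abs]
      push_cast
      rw [mul_comm (Complex.exp (Complex.I * ξ * x)), mul_assoc]
      congr 3
      · ring
      · ring
    rw [key, hf, inv_mul_cancel_left₀ hne, qExp, if_pos rfl, Real.rpow_two, sq_abs]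
    push_cast
    congr 1
    ring

/-- For `α = 2` one has `s* = s` and `(1+s)/(3-s) = Q` exactly, and `s < 2` leaves the dilation free
to make the width `1`. -/
lemma exists_qGaussian_preimage {α q : ℝ} (hα : α = 2) (hq : 1 ≤ q) {k : ℤ}
    (hk : (k : ℝ) * (q - 1) < α) (hqk : qSeq α q k < 2) :
    ∃ g ∈ G (qSeq α q (k - 1)) α, IsDensity g ∧
      ∀ ξ : ℝ, qFourier (qStar α q (k - 1)) g ξ = (qExp (qSeq α q k) (-(|ξ| ^ α)) : ℂ) := by
  subst hα
  rcases hq.eq_or_lt with rfl | hq1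
  · rw [qSeq_one, qStar_one, qSeq_one]
    exact exists_gaussian_preimage
  · have hrec := qSeq_pred_sub_one two_pos hq hk
    have hQ : 1 < qSeq 2 q k := by
      have h1 : 0 < 2 - k * (q - 1) := by linarith
      have : 0 < 2 * (q - 1) / (2 - k * (q - 1)) := div_pos (by linarith) h1
      rw [qSeq]
      linarith
    rw [qStar, zeta, show ∀ x : ℝ, 1 + 2 * (x - 1) / 2 = x from fun x => by ring]
    set Q := qSeq 2 q k
    set s := qSeq 2 q (k - 1)
    have hs : s = 1 + 2 * (Q - 1) / (2 + (Q - 1)) := by linarith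
    have hd : 0 < 2 + (Q - 1) := by linarith
    have hs1 : 1 < s := by
      have : 0 < 2 * (Q - 1) / (2 + (Q - 1)) := div_pos (by linarith) hd
      linarith
    have hs2 : s < 2 := by
      have : 2 * (Q - 1) / (2 + (Q - 1)) < 1 := by rw [div_lt_one hd]; linarith
      linarith
    have ht : (1 + s) / (3 - s) = Q := by
      rw [div_eq_iff (by linarith), hs]
      field_simp
      ring
    obtain ⟨g, hg, hgd, β, -, hβ, hF⟩ := exists_qGaussian hs1 (by linarith) one_pos
    refine ⟨g, hg, hgd, fun ξ => ?_⟩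
    rw [hF, ht, hβ hs2.ne, one_mul]

/-- The stable law is not constructed separately: the variables `Z N` already provide laws whose
characteristic functions converge to `e^{-|ξ|^α}`. -/
lemma exists_stable_density {Ω : Type*} [MeasurableSpace Ω] {P : Measure Ω}
    [IsProbabilityMeasure P] {α : ℝ} (h0 : 0 < α) {Z : ℕ → Ω → ℝ}
    (hZ : ∀ N, 1 ≤ N → HasPDF (Z N) P volume)
    (hlim : ∀ ξ, Tendsto (fun N => qFourierRV 1 P (Z N) ξ) atTop (𝓝 (qExp 1 (-(|ξ| ^ α)) : ℂ))) :
    ∃ g : ℝ → ℝ, IsDensity g ∧ ∀ ξ : ℝ, qFourier 1 g ξ = (qExp 1 (-(|ξ| ^ α)) : ℂ) := by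
  have e : ∀ ξ : ℝ, qExp 1 (-(|ξ| ^ α)) = Real.exp (-(|ξ| ^ α)) := fun ξ => by simp [qExp]
  simp only [e] at hlim ⊢
  -- The shift to `N + 1` avoids `Z 0`, for which no density is assumed.
  have hpr : ∀ N, IsProbabilityMeasure (P.map (Z (N + 1))) := fun N =>
    Measure.isProbabilityMeasure_map (hZ (N + 1) (by omega)).aemeasurable'
  refine exists_isDensity_of_tendsto_charFun (μ := fun N => P.map (Z (N + 1)))
    (φ := fun ξ => (Real.exp (-(|ξ| ^ α)) : ℂ)) ?_ ?_ ?_ fun ξ => ?_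
  · refine Complex.continuous_ofReal.comp (Real.continuous_exp.comp ?_)
    exact (continuous_abs.rpow_const fun _ => Or.inr h0.le).neg
  · exact (integrable_exp_neg_abs_rpow h0).ofReal
  · simp [Real.zero_rpow h0.ne']
  · have := (tendsto_add_atTop_iff_nat 1).2 (hlim ξ)
    refine this.congr fun N => ?_
    exact (charFun_map_eq_qFourierRV (hZ (N + 1) (by omega)) ξ).symm

end QLimit

end

/-! ### The limit theorem -/

theorem theorem1 {Ω : Type*} [MeasurableSpace Ω] (P : Measure Ω) [IsProbabilityMeasure P]
    (α q : ℝ) (hα0 : 0 < α) (hα2 : α ≤ 2) (hq1 : 1 ≤ q) (hq2 : q < min 2 (1 + α))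
    (k : ℤ) (hk : (k : ℝ) * (q - 1) < α) (hqk : QLimit.qSeq α q k < 2)
    (X : ℕ → Ω → ℝ) (f : ℝ → ℝ)
    (hf : QLimit.IsDensity f) (hsymm : ∀ x, f (-x) = f x)
    (hX : ∀ i, Measurable (X i))
    (hlaw : ∀ i, P.map (X i) = volume.withDensity (fun x => ENNReal.ofReal (f x)))
    (hcond : QLimit.StableCondition (QLimit.qSeq α q k) α f)
    (hindep : QLimit.QIndep (QLimit.qSeq α q k) P X) :
    -- the scaling constant is positive and the normalized sums have densities
    0 < QLimit.mu (QLimit.qSeq α q k) α f ∧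
    (∀ N : ℕ, 1 ≤ N →
      HasPDF (QLimit.normSum (QLimit.qSeq α q k) α (QLimit.mu (QLimit.qSeq α q k) α f) X N)
        P volume) ∧
    -- convergence of the `q_{α,k}`-Fourier transforms
    TendstoLocallyUniformly
      (fun (N : ℕ) (ξ : ℝ) => QLimit.qFourierRV (QLimit.qSeq α q k) P
        (QLimit.normSum (QLimit.qSeq α q k) α (QLimit.mu (QLimit.qSeq α q k) α f) X N) ξ)
      (fun ξ : ℝ => (QLimit.qExp (QLimit.qSeq α q k) (-(|ξ| ^ α)) : ℂ)) atTop ∧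
    -- `α = 2`: the limit is exactly the transform of a density in `𝒢_{q_{α,k-1}}[α]`
    (α = 2 → ∃ g ∈ QLimit.G (QLimit.qSeq α q (k - 1)) α, QLimit.IsDensity g ∧
      ∀ ξ : ℝ, QLimit.qFourier (QLimit.qStar α q (k - 1)) g ξ =
        (QLimit.qExp (QLimit.qSeq α q k) (-(|ξ| ^ α)) : ℂ)) ∧
    -- `q > 1`: the limit is such a transform in the asymptotic sense
    (1 < q → ∃ (c : ℝ) (g : ℝ → ℝ), 0 < c ∧ (QLimit.qStar α q (k - 1) ≠ 2 → c = 1) ∧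
      QLimit.IsAsympImage (QLimit.qSeq α q (k - 1)) α c g
        (fun ξ => QLimit.qExp (QLimit.qSeq α q k) (-(|ξ| ^ α)))) ∧
    -- `q = 1`: the limit is the transform of a classical symmetric `α`-stable density
    (q = 1 → ∃ g : ℝ → ℝ, QLimit.IsDensity g ∧
      ∀ ξ : ℝ, QLimit.qFourier (QLimit.qStar α q (k - 1)) g ξ =
        (QLimit.qExp (QLimit.qSeq α q k) (-(|ξ| ^ α)) : ℂ)) := by
  have hQ1 := QLimit.one_le_qSeq hα0 hq1 hk
  have hm0 := (QLimit.mu_pos_and_tendsto hQ1 hqk hα0 hf hsymm hcond).1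
  have hZ := fun (N : ℕ) (hN : 1 ≤ N) =>
    QLimit.hasPDF_normSum (q := QLimit.qSeq α q k) (α := α) hm0 hX hf hlaw hindep hN
  have hlim := QLimit.tendstoLocallyUniformly_normSum hQ1 hqk hα0 hX hf hsymm hlaw hcond hindep
  refine ⟨hm0, hZ, hlim, fun h2 => QLimit.exists_qGaussian_preimage h2 hq1 hk hqk, fun h1 => ?_,
    fun h1 => ?_⟩
  · refine QLimit.exists_isAsympImage hα0 ?_ (QLimit.qSeq_pred_sub_one hα0 hq1 hk)
    have hd : 0 < α - k * (q - 1) := by linarith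
    have : 0 < α * (q - 1) / (α - k * (q - 1)) := div_pos (mul_pos hα0 (by linarith)) hd
    rw [QLimit.qSeq]
    linarith
  · subst h1
    simp only [QLimit.qSeq_one, QLimit.qStar_one] at hZ hlim ⊢
    exact QLimit.exists_stable_density hα0 hZ fun ξ => (tendstoLocallyUniformlyOn_univ.2 hlim).tendsto_at (Set.mem_univ ξ)
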